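/- Let $\theta>0$ and let $Y^\infty=(Y_1,Y_2,\dots)$ be an enumeration of the points of a Poisson point process on $(0,\infty)$ with intensity $\theta y^{-1}e^{-y}\,dy$. Let $\ddot Y^\infty=(\ddot Y_1,\ddot Y_2,\dots)$ be its size-biased random rearrangement: given $Y^\infty$, for every $k$ and all distinct indices $i_1,\dots,i_k$, $$\mathbb P\big(\ddot Y_1=Y_{i_1},\dots,\ddot Y_k=Y_{i_k}\mid Y^\infty\big)=\prod_{j=1}^{k}\frac{Y_{i_j}}{|Y^\infty|-\sum_{l<j}Y_{i_l}},\qquad |Y^\infty|=\sum_i Y_i ,$$ and let $\ddot\gamma_\theta$ be the law of $\ddot Y^\infty$ on $\mathbb R^{\mathbb N}$. For $a>0$ and $m\in\mathbb N=\{0,1,\dots\}$ let $L_m^{a}(z)=\frac{(a)_m}{m!}\,{}_1F_1(-m;a;z)$ be the Laguerre polynomial orthogonal with respect to the Gamma$(a)$ density, and for $\alpha,\beta>0$ let $R_k^{(\alpha,\beta)}(x)={}_2F_1(-k,k+\alpha+\beta-1;\beta;1-x)$ be the shifted Jacobi polynomial orthogonal with respect to the Beta$(\alpha,\beta)$ distribution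 on $[0,1]$, with $R_k^{(\alpha,\beta)}(1)=1$. For $n\in\mathbb N^\infty$ with $|n|=\sum_j n_j<\infty$ put $N_j=\sum_{i>j}n_i$ and $$\ddot R_n^{\theta}(x)=\prod_{j=1}^{\infty}R_{n_j}^{(1,\theta+2N_j)}\Big(\frac{x_j}{1-s_{j-1}}\Big)(1-s_{j-1})^{n_j},\qquad s_{j-1}=\sum_{i<j}x_i .$$ For $m\in\mathbb N$ and $n\in\mathbb N^\infty$ with $|n|<\infty$ define, with $|y|=\sum_i y_i$, $$L^{\theta *}_{(m,n)}(y)=L_m^{\theta+2|n|}(|y|)\,|y|^{|n|}\,\ddot R_n^{\theta}\Big(\frac{y}{|y|}\Big).$$ Then on the summable sequences $y$ with positive terms each $L^{\theta *}_{(m,n)}$ is a polynomial of total degree $m+|n|$ in $|y|$ and finitely many of the coordinates $y_j$, and these functions form an orthogonal system with respect to $\ddot\gamma_\theta$: all of them lie in $L^2(\ddot\gamma_\theta)$, none has norm zero, and $$\int L^{\theta *}_{(m,n)}\,L^{\theta *}_{(m',n')}\,d\ddot\gamma_\theta=0\qquad\text{whenever }(m,n)\neq(m',n').$$ -/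

import Mathlib

open MeasureTheory ProbabilityTheory Polynomial
open scoped ENNReal NNReal

namespace GammaLaguerre

noncomputable section

/-! ### Classical orthogonal polynomials -/

/-- The rising factorial `a (a + 1) ⋯ (a + k - 1)`. -/
def rising (a : ℝ) (k : ℕ) : ℝ := (ascPochhammer ℝ k).eval a

/-- The Laguerre polynomial of degree `m` with positive parameter `a`,
`(a)_m / m! * ₁F₁(-m; a; y)`, associated with the Gamma density `y ^ (a - 1) * exp (-y) / Γ(a)`. -/
def laguerre (a : ℝ) (m : ℕ) : ℝ[X] :=
  C (rising a m / m.factorial) *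
    ∑ k ∈ Finset.range (m + 1), C (rising (-(m : ℝ)) k / (rising a k * k.factorial)) * X ^ k

/-- The Jacobi polynomial on `[-1, 1]` with weight `(1 - x) ^ a * (1 + x) ^ b`,
`(a + 1)_n / n! * ₂F₁(-n, n + a + b + 1; a + 1; (1 - x) / 2)`. -/
def jacobi (a b : ℝ) (n : ℕ) : ℝ[X] :=
  C (rising (a + 1) n / n.factorial) *
    ∑ k ∈ Finset.range (n + 1),
      C (rising (-(n : ℝ)) k * rising (n + a + b + 1) k / (rising (a + 1) k * k.factorial)) *
        (C (1 / 2) * (1 - X)) ^ k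

/-- The shifted Jacobi polynomial `R_n^{α,β}` on `[0, 1]`, associated with the Beta`(α, β)`
distribution and standardized to take the value `1` at `1`. -/
def shiftedJacobi (α β : ℝ) (n : ℕ) : ℝ[X] :=
  C ((jacobi (β - 1) (α - 1) n).eval 1)⁻¹ * (jacobi (β - 1) (α - 1) n).comp (2 * X - 1)

/-! ### Polynomials on sequences

Coordinates of sequences are numbered from `0`; multi-indices `n ∈ ℕ^∞` with `|n| < ∞` are finitely
supported functions `ℕ →₀ ℕ`, and `|n|` is `Finsupp.degree n`. -/

/-- `N_j = ∑_{i > j} n_i`. -/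
def tailDegree (n : ℕ →₀ ℕ) (j : ℕ) : ℕ := ∑ i ∈ n.support with j < i, n i

/-- The polynomials `R_n` for the GEM`(θ)` distribution,
`∏_j R_{n_j}^{(1, θ + 2 N_j)} (x_j / (1 - s_{j-1})) * (1 - s_{j-1}) ^ n_j` with
`s_{j-1} = ∑_{i < j} x_i`. The factors with `n_j = 0` are equal to `1`, so the product runs over the
support of `n`. -/
def gemPoly (θ : ℝ) (n : ℕ →₀ ℕ) (x : ℕ → ℝ) : ℝ :=
  ∏ j ∈ n.support,
    (shiftedJacobi 1 (θ + 2 * tailDegree n j) (n j)).eval (x j / (1 - ∑ i ∈ Finset.range j, x i)) *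
      (1 - ∑ i ∈ Finset.range j, x i) ^ n j

/-- The infinite-dimensional multiple Laguerre polynomials
`L_m^{θ + 2|n|}(|y|) * |y| ^ |n| * R_n(y / |y|)`, where `|y| = ∑ y_i`. -/
def multipleLaguerre (θ : ℝ) (m : ℕ) (n : ℕ →₀ ℕ) (y : ℕ → ℝ) : ℝ :=
  (laguerre (θ + 2 * n.degree) m).eval (∑' i, y i) * (∑' i, y i) ^ n.degree *
    gemPoly θ n (fun j => y j / ∑' i, y i)

/-- `f` is, on the summable sequences with positive terms, a polynomial of total degree `d` in
`|y| = ∑ y_i` (the variable `none`) and finitely many of the coordinates `y_j` (the variables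
`some j`). -/
def IsPolynomialOfDegree (f : (ℕ → ℝ) → ℝ) (d : ℕ) : Prop :=
  ∃ p : MvPolynomial (Option ℕ) ℝ, p.totalDegree = d ∧
    ∀ y : ℕ → ℝ, (∀ i, 0 < y i) → Summable y →
      f y = MvPolynomial.eval (fun o : Option ℕ => o.elim (∑' i, y i) y) p

/-- An orthogonal system of nonzero functions in `L²(μ)`. -/
structure IsOrthogonalSystem {ι E : Type*} [MeasurableSpace E] (μ : Measure E) (f : ι → E → ℝ) :
    Prop where
  memLp : ∀ i, MemLp (f i) 2 μ
  orthogonal : ∀ i j, i ≠ j → ∫ y, f i y * f j y ∂μ = 0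
  norm_pos : ∀ i, 0 < ∫ y, f i y ^ 2 ∂μ

/-! ### The Gamma point process and its size-biased rearrangement -/

/-- The intensity measure `θ * y⁻¹ * exp (-y) dy` on `(0, ∞)`. -/
def gammaIntensity (θ : ℝ) : Measure ℝ :=
  (volume.restrict (Set.Ioi 0)).withDensity
    fun y => ENNReal.ofReal (θ * y⁻¹ * Real.exp (-y))

/-- The number of points of the sequence `y` in the set `A`. -/
def count (y : ℕ → ℝ) (A : Set ℝ) : ℝ≥0∞ := (Measure.sum fun i => Measure.dirac (y i)) A

/-- `Y 0, Y 1, …` is an enumeration (in an arbitrary, possibly random, order) of the points of a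
Poisson process with `σ`-finite intensity measure `Λ` of infinite total mass: the numbers of points
in pairwise disjoint sets are independent, and the number of points in a set `A` of finite intensity
has the Poisson distribution with mean `Λ A`. -/
structure IsPoissonProcess {Ω : Type*} [MeasurableSpace Ω] (P : Measure Ω) (Λ : Measure ℝ)
    (Y : ℕ → Ω → ℝ) : Prop where
  measurable : ∀ i, Measurable (Y i)
  count_law : ∀ A : Set ℝ, MeasurableSet A → Λ A ≠ ∞ →
    HasLaw (fun ω => count (fun i => Y i ω) A)
      ((poissonMeasure (Λ A).toNNReal).map (fun k : ℕ => (k : ℝ≥0∞))) P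
  count_indep : ∀ (r : ℕ) (A : Fin r → Set ℝ), (∀ i, MeasurableSet (A i)) →
    Pairwise (fun i j => Disjoint (A i) (A j)) →
    iIndepFun (fun i ω => count (fun l => Y l ω) (A i)) P

/-- The random indices `π 0, π 1, …` arrange the positive terms of the random sequence `Y` in
size-biased random order: given `Y`, they are drawn successively without replacement, and each time
an index `i` not yet drawn is chosen with probability `Y i` divided by the sum of the terms not yet
drawn. Thus, given `Y`, distinct `i 0, …, i (k - 1)` are the first `k` indices drawn with
probability `∏_j Y_{i_j} / (|Y| - ∑_{l < j} Y_{i_l})`. -/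
structure IsSizeBiasedOrder {Ω : Type*} [MeasurableSpace Ω] (P : Measure Ω)
    (Y : ℕ → Ω → ℝ) (π : ℕ → Ω → ℕ) : Prop where
  measurable : ∀ k, Measurable (π k)
  condProb : ∀ (k : ℕ) (i : Fin k → ℕ), Function.Injective i →
    P⟦{ω | ∀ j : Fin k, π j ω = i j} |
        MeasurableSpace.comap (fun ω l => Y l ω) MeasurableSpace.pi⟧ =ᵐ[P]
      fun ω => ∏ j : Fin k,
        Y (i j) ω / (∑' l, Y l ω - ∑ l ∈ Finset.univ.filter (· < j), Y (i l) ω)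

end

end GammaLaguerre

open Filter Topology

namespace GammaLaguerre

noncomputable section

/-! ### The exponential `exp (-x)` on `[0, ∞]` -/

/-! In suitable coordinates the reference measure is a product measure and every multiple Laguerre
polynomial is a product of one-variable polynomials. Let `S` be the sum of the points, and let `V_j`
be the `j`-th term in size-biased order divided by what is left of `S` before it is drawn. Then `S`
is Gamma(`θ`), the `V_j` are independent Beta(`1, θ`), and all are independent (`map_arrangedFrac`).
Since `1 - s_{j-1} = ∏_{i<j} (1 - V_i)`, the factors `(1 - s_{j-1}) ^ n_j` regroup into `∏_i (1 -
V_i) ^ N_i`, so the function equals `radialPoly` at `S` times the product of the `stickPoly` at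
`V_j` (`multipleLaguerre_eq_prod`), and integrals of products factorize.

Orthogonality is then one-dimensional. If `n ≠ n'`, let `j` be the last index where they differ.
Then `N_j = N'_j`, the common weight `(1 - v) ^ (2 N_j)` tilts Beta(`1, θ`) to Beta(`1, θ + 2 N_j`),
and two Jacobi polynomials of different degrees for that law are orthogonal. If `n = n'` and `m ≠
m'`, the weight `x ^ (2|n|)` tilts Gamma(`θ`) to Gamma(`θ + 2|n|`), and Laguerre orthogonality
applies. Both classical relations reduce to moments and to the vanishing of an iterated finite
difference of a polynomial of too low degree (`sum_choose_mul_eval_eq_zero`). Norms are positive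
because the marginals have no atoms and a nonzero polynomial has finitely many roots.

The law of the coordinates comes from the Poisson process. Independence of counts gives the Laplace
functional, and differentiating it gives a Mecke formula (`lintegral_sumDistinct_prod`): removing
`k` distinct points leaves a remainder distributed like the whole process. For the Gamma intensity
the remaining sum is Gamma(`θ`), by a Frullani integral and uniqueness of Laplace transforms
(`lintegral_sumDistinct`). Weighting by the size-biased probabilities and changing variables one
point at a time yields the product law (`lintegral_stickFrac`). Finally `E ∏_{j<k} (1 - V_j) = (θ /
(θ + 1)) ^ k → 0`, so the rearrangement exhausts the points and its sum is `S`
(`ae_hasSum_arrangement`).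

Polynomiality is separate: the powers of `|y|` and of `1 - s_{j-1}` clear all denominators and leave
a homogeneous polynomial of degree `|n|` times a Laguerre polynomial in `|y|`. -/

/-- `exp (-x)` for `x ∈ [0, ∞]`. -/
def negExp (x : ℝ≥0∞) : ℝ≥0∞ := EReal.exp (-(x : EReal))

lemma negExp_ofReal {x : ℝ} (hx : 0 ≤ x) :
    negExp (ENNReal.ofReal x) = ENNReal.ofReal (Real.exp (-x)) := by
  rw [negExp, EReal.coe_ennreal_ofReal, max_eq_left hx, ← EReal.coe_neg, EReal.exp_coe]

lemma negExp_coe (x : ℝ≥0) : negExp x = ENNReal.ofReal (Real.exp (-x)) := by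
  rw [← negExp_ofReal x.coe_nonneg, ENNReal.ofReal_coe_nnreal]

@[simp] lemma negExp_zero : negExp 0 = 1 := by simp [negExp]

@[simp] lemma negExp_top : negExp ∞ = 0 := by simp [negExp]

lemma negExp_add (x y : ℝ≥0∞) : negExp (x + y) = negExp x * negExp y := by
  rw [negExp, negExp, negExp, ← EReal.exp_add, EReal.coe_ennreal_add, EReal.neg_add, sub_eq_add_neg]
  · left; simp
  · right; simp

lemma negExp_sum {ι : Type*} (s : Finset ι) (x : ι → ℝ≥0∞) :
    negExp (∑ i ∈ s, x i) = ∏ i ∈ s, negExp (x i) := by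
  classical
  induction s using Finset.induction_on with
  | empty => simp
  | insert a s ha ih => rw [Finset.sum_insert ha, Finset.prod_insert ha, negExp_add, ih]

lemma negExp_antitone : Antitone negExp := fun x y h => by
  simpa [negExp] using h

lemma negExp_le_one (x : ℝ≥0∞) : negExp x ≤ 1 := by
  simpa using negExp_antitone (zero_le (a := x))

lemma negExp_ne_top (x : ℝ≥0∞) : negExp x ≠ ∞ :=
  ne_top_of_le_ne_top ENNReal.one_ne_top (negExp_le_one x)

lemma continuous_negExp : Continuous negExp :=
  ENNReal.continuous_exp.comp (continuous_neg.comp continuous_coe_ennreal_ereal)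

@[fun_prop]
lemma measurable_negExp : Measurable negExp := continuous_negExp.measurable

/-- The difference quotients of `t ↦ 1 - exp (-t b)` along `t = 2 ^ (-m)`. -/
def expQuotient (m : ℕ) (b : ℝ≥0∞) : ℝ≥0∞ := 2 ^ m * (1 - negExp (b / 2 ^ m))

@[fun_prop]
lemma measurable_expQuotient (m : ℕ) : Measurable (expQuotient m) := by
  unfold expQuotient
  fun_prop

lemma expQuotient_mono_right (m : ℕ) : Monotone (expQuotient m) := fun x y h => by
  unfold expQuotient
  gcongr
  exact negExp_antitone (by gcongr)

/-- Passing from `m` to `m + 1` replaces `1 - x ^ 2` by `2 (1 - x)` with `x = exp (-b / 2 ^ (m +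
1))`, and `2 (1 - x) - (1 - x ^ 2) = (1 - x) ^ 2 ≥ 0`. Monotonicity along dyadic steps lets monotone
convergence replace any domination argument. -/
lemma expQuotient_mono_left (b : ℝ≥0∞) : Monotone (fun m => expQuotient m b) := by
  refine monotone_nat_of_le_succ fun m => ?_
  unfold expQuotient
  obtain ⟨x, hx⟩ : ∃ x : ℝ≥0, (x : ℝ≥0∞) = negExp (b / 2 ^ (m + 1)) :=
    ⟨_, ENNReal.coe_toNNReal (negExp_ne_top _)⟩
  have h : negExp (b / 2 ^ m) = x * x := by
    rw [hx, ← negExp_add]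
    congr 1
    rw [pow_succ, ← two_mul, ENNReal.div_eq_inv_mul, ENNReal.div_eq_inv_mul,
      ENNReal.mul_inv (by simp) (by simp), mul_comm, mul_comm 2 _, mul_comm _ b, mul_assoc b,
      mul_assoc, ENNReal.inv_mul_cancel (by simp) (by simp), mul_one]
  have hx1 : (x : ℝ≥0∞) ≤ 1 := hx.symm ▸ negExp_le_one _
  rw [h, ← hx, pow_succ, mul_assoc]
  gcongr
  norm_cast at hx1 ⊢
  rw [← NNReal.coe_le_coe]
  have h2 : x * x ≤ 1 := mul_le_one' hx1 hx1
  rw [NNReal.coe_mul, NNReal.coe_sub h2, NNReal.coe_sub hx1]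
  push_cast
  nlinarith [sq_nonneg ((x : ℝ) - 1)]

lemma tendsto_expQuotient (b : ℝ≥0∞) : Tendsto (fun m => expQuotient m b) atTop (𝓝 b) := by
  have h2 : Tendsto (fun m : ℕ => (2 : ℝ≥0∞) ^ m) atTop (𝓝 ∞) :=
    ENNReal.tendsto_pow_atTop_nhds_top_iff.2 (by norm_num)
  induction b with
  | top => simp [expQuotient, ENNReal.top_div, h2]
  | coe b =>
    have key (m : ℕ) : expQuotient m b
        = ENNReal.ofReal (2 ^ m * (1 - Real.exp (-(b / 2 ^ m)))) := by
      unfold expQuotient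
      have : (b : ℝ≥0∞) / 2 ^ m = ENNReal.ofReal (b / 2 ^ m) := by
        rw [ENNReal.ofReal_div_of_pos (by positivity)]
        simp
      rw [this, negExp_ofReal (by positivity), ENNReal.ofReal_mul (by positivity),
        ENNReal.ofReal_sub _ (Real.exp_nonneg _)]
      simp
    simp_rw [key]
    rw [← ENNReal.ofReal_coe_nnreal]
    refine (ENNReal.continuous_ofReal.tendsto _).comp ?_
    have hd : HasDerivAt (fun t : ℝ => 1 - Real.exp (-(t * b))) b 0 := by
      have := (((hasDerivAt_id (0 : ℝ)).mul_const (b : ℝ)).neg.exp).const_sub 1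
      simpa using this
    have ht : Tendsto (fun m : ℕ => ((2 : ℝ) ^ m)⁻¹) atTop (𝓝[≠] 0) := by
      refine tendsto_nhdsWithin_iff.2 ⟨?_, Eventually.of_forall fun m => ?_⟩
      · exact tendsto_inv_atTop_zero.comp (tendsto_pow_atTop_atTop_of_one_lt (by norm_num))
      · simp
    refine (hd.tendsto_slope_zero.comp ht).congr fun m => ?_
    simp [div_eq_inv_mul]

lemma expQuotient_le (m : ℕ) (b : ℝ≥0∞) : expQuotient m b ≤ b :=
  (expQuotient_mono_left b).ge_of_tendsto (tendsto_expQuotient b) m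

lemma tendsto_expQuotient_of_monotone {x : ℕ → ℝ≥0∞} {b : ℝ≥0∞} (hx : Monotone x)
    (h : Tendsto x atTop (𝓝 b)) : Tendsto (fun m => expQuotient m (x m)) atTop (𝓝 b) := by
  refine tendsto_order.2 ⟨fun a ha => ?_, fun a ha => Eventually.of_forall fun m =>
    ((expQuotient_le m _).trans (hx.ge_of_tendsto h m)).trans_lt ha⟩
  obtain ⟨M, hM⟩ := ((tendsto_order.1 h).1 a ha).exists
  filter_upwards [(tendsto_order.1 (tendsto_expQuotient (x M))).1 a hM, eventually_ge_atTop M]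
    with m hm hmM
  exact hm.trans_le (expQuotient_mono_right m (hx hmM))

/-! ### The Laplace functional of a Poisson process -/

lemma lintegral_negExp_poissonMeasure (r c : ℝ≥0) :
    ∫⁻ k, negExp (c * (k : ℝ≥0∞)) ∂(poissonMeasure r) = negExp (r * (1 - negExp c)) := by
  have h1 : (r : ℝ≥0∞) * (1 - negExp c) = ENNReal.ofReal (r * (1 - Real.exp (-c))) := by
    rw [negExp_coe, ENNReal.ofReal_mul r.coe_nonneg, ENNReal.ofReal_sub _ (Real.exp_nonneg _)]
    simp
  have hc : Real.exp (-c) ≤ 1 := by simp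
  rw [h1, negExp_ofReal (mul_nonneg r.coe_nonneg (by linarith)), lintegral_countable']
  have h2 (k : ℕ) : negExp (c * (k : ℝ≥0∞)) * poissonMeasure r {k}
      = ENNReal.ofReal (Real.exp (-r) * ((r * Real.exp (-c)) ^ k / k.factorial)) := by
    have : (c : ℝ≥0∞) * (k : ℝ≥0∞) = ENNReal.ofReal (c * k) := by
      rw [ENNReal.ofReal_mul c.coe_nonneg]; simp
    rw [poissonMeasure_singleton, this, negExp_ofReal (by positivity),
      ← ENNReal.ofReal_mul (Real.exp_nonneg _)]
    congr 1
    rw [mul_pow, ← Real.exp_nat_mul]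
    ring_nf
  simp_rw [h2]
  have hs := (NormedSpace.expSeries_div_hasSum_exp ((r : ℝ) * Real.exp (-c))).mul_left
    (Real.exp (-r))
  rw [← ENNReal.ofReal_tsum_of_nonneg (fun k => by positivity) hs.summable, hs.tsum_eq,
    ← Real.exp_eq_exp_ℝ, ← Real.exp_add]
  ring_nf

lemma lintegral_sum_dirac {y : ℕ → ℝ} {f : ℝ → ℝ≥0∞} (hf : Measurable f) :
    ∫⁻ x, f x ∂(Measure.sum fun i => Measure.dirac (y i)) = ∑' i, f (y i) := by
  rw [lintegral_sum_measure]
  simp_rw [lintegral_dirac' _ hf]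

section Poisson

variable {Ω : Type*} [MeasurableSpace Ω] {P : Measure Ω} {Λ : Measure ℝ} {Y : ℕ → Ω → ℝ}

lemma IsPoissonProcess.measurable_count (hY : IsPoissonProcess P Λ Y) {A : Set ℝ}
    (hA : MeasurableSet A) : Measurable fun ω => count (fun i => Y i ω) A := by
  unfold count
  simp_rw [Measure.sum_apply _ hA, Measure.dirac_apply' _ hA]
  exact Measurable.tsum fun i => (measurable_const.indicator hA).comp (hY.measurable i)

lemma IsPoissonProcess.lintegral_negExp_count (hY : IsPoissonProcess P Λ Y) {A : Set ℝ}
    (hA : MeasurableSet A) (hΛ : Λ A ≠ ∞) {c : ℝ≥0∞} (hc : c ≠ ∞) :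
    ∫⁻ ω, negExp (c * count (fun i => Y i ω) A) ∂P = negExp ((1 - negExp c) * Λ A) := by
  lift c to ℝ≥0 using hc
  have h := hY.count_law A hA hΛ
  rw [← lintegral_map (f := fun x => negExp (c * x)) (by fun_prop) (hY.measurable_count hA),
    h.map_eq, lintegral_map (by fun_prop) (by fun_prop), lintegral_negExp_poissonMeasure,
    ENNReal.coe_toNNReal hΛ, mul_comm]

/-- The sum of `f` over the points is a combination of the counts in the level sets of `f`, which
are disjoint, so the counts are independent and the expectation splits. The level `0` is discarded
because its intensity may be infinite. -/
lemma IsPoissonProcess.lintegral_negExp_simpleFunc [IsProbabilityMeasure P]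
    (hY : IsPoissonProcess P Λ Y)
    (f : SimpleFunc ℝ ℝ≥0∞) (hf : ∀ x, f x ≠ ∞) (hΛ : ∀ c ≠ 0, Λ (f ⁻¹' {c}) ≠ ∞) :
    ∫⁻ ω, negExp (∑' i, f (Y i ω)) ∂P = negExp (∫⁻ y, 1 - negExp (f y) ∂Λ) := by
  classical
  set s := f.range.filter (· ≠ 0) with hs
  let e := s.equivFin
  have hsum (μ : Measure ℝ) (φ : ℝ≥0∞ → ℝ≥0∞) (hφ : φ 0 = 0) :
      ∫⁻ y, φ (f y) ∂μ = ∑ j, φ (e.symm j) * μ (f ⁻¹' {(e.symm j : ℝ≥0∞)}) := by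
    rw [show (fun y => φ (f y)) = ⇑(f.map φ) from rfl, SimpleFunc.lintegral_eq_lintegral,
      SimpleFunc.map_lintegral,
      Fintype.sum_equiv e.symm _ (fun c : s => φ c * μ (f ⁻¹' {(c : ℝ≥0∞)})) (fun _ => rfl),
      Finset.sum_coe_sort s (fun c => φ c * μ (f ⁻¹' {c})), hs, Finset.sum_filter]
    refine Finset.sum_congr rfl fun c _ => ?_
    split_ifs with h
    · rfl
    · push Not at h
      simp [h, hφ]
  have hmem (j) : ((e.symm j : s) : ℝ≥0∞) ∈ f.range ∧ ((e.symm j : s) : ℝ≥0∞) ≠ 0 :=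
    Finset.mem_filter.1 (e.symm j).2
  have hfin (j) : ((e.symm j : s) : ℝ≥0∞) ≠ ∞ := by
    obtain ⟨x, hx⟩ := SimpleFunc.mem_range.1 (hmem j).1
    exact hx ▸ hf x
  have hind := hY.count_indep s.card (fun j => f ⁻¹' {(e.symm j : ℝ≥0∞)})
    (fun j => f.measurableSet_preimage _) (fun i j hij => by
      refine Disjoint.preimage _ (Set.disjoint_singleton.2 fun h => hij ?_)
      exact e.symm.injective (Subtype.ext h))
  have h1 (ω) : negExp (∑' i, f (Y i ω)) = ∏ j, negExp ((e.symm j : ℝ≥0∞) *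
      count (fun i => Y i ω) (f ⁻¹' {(e.symm j : ℝ≥0∞)})) := by
    rw [← lintegral_sum_dirac f.measurable, hsum _ (fun c => c) rfl, negExp_sum]
    rfl
  simp_rw [h1]
  rw [lintegral_prod_eq_prod_lintegral_of_indepFun _
    (fun j ω => negExp ((e.symm j : ℝ≥0∞) * count (fun i => Y i ω) (f ⁻¹' {(e.symm j : ℝ≥0∞)})))
    (hind.comp (fun j x => negExp ((e.symm j : ℝ≥0∞) * x)) (fun j => by fun_prop))
    (fun j => measurable_negExp.comp
      ((hY.measurable_count (f.measurableSet_preimage _)).const_mul _)),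
    hsum Λ (fun c => 1 - negExp c) (by simp), negExp_sum]
  exact Finset.prod_congr rfl fun j _ => hY.lintegral_negExp_count (f.measurableSet_preimage _)
    (hΛ _ (hmem j).2) (hfin j)

/-- The Laplace functional of a Poisson process. -/
lemma IsPoissonProcess.lintegral_negExp [IsProbabilityMeasure P] [SigmaFinite Λ]
    (hY : IsPoissonProcess P Λ Y) {f : ℝ → ℝ≥0∞} (hf : Measurable f) :
    ∫⁻ ω, negExp (∑' i, f (Y i ω)) ∂P = negExp (∫⁻ y, 1 - negExp (f y) ∂Λ) := by
  -- Cutting off to sets of finite intensity makes the nonzero levels of the approximating simple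
  -- functions have finite intensity, as the simple case requires.
  let g (n : ℕ) : SimpleFunc ℝ ℝ≥0∞ := (SimpleFunc.eapprox f n).restrict (spanningSets Λ n)
  have hg (n y) : g n y = (spanningSets Λ n).indicator (SimpleFunc.eapprox f n) y := by
    rw [SimpleFunc.restrict_apply _ (measurableSet_spanningSets Λ n)]
  have hmono (y) : Monotone fun n => g n y := by
    intro m n hmn
    simp only [hg]
    exact Set.indicator_le_indicator_of_subset (monotone_spanningSets Λ hmn) (fun _ => zero_le) y
      |>.trans (Set.indicator_le_indicator (SimpleFunc.monotone_eapprox f hmn y))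
  have hlim (y) : Tendsto (fun n => g n y) atTop (𝓝 (f y)) := by
    have h1 : Tendsto (fun n => SimpleFunc.eapprox f n y) atTop (𝓝 (f y)) := by
      rw [← SimpleFunc.iSup_eapprox_apply hf y]
      exact tendsto_atTop_iSup fun m n h => SimpleFunc.monotone_eapprox f h y
    refine h1.congr' ?_
    filter_upwards [eventually_ge_atTop (spanningSetsIndex Λ y)] with n hn
    rw [hg, Set.indicator_of_mem]
    exact monotone_spanningSets Λ hn (mem_spanningSetsIndex Λ y)
  have hlim_lintegral (μ : Measure ℝ) {φ : ℝ≥0∞ → ℝ≥0∞} (h1 : Monotone φ) (h2 : Continuous φ) :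
      Tendsto (fun n => ∫⁻ y, φ (g n y) ∂μ) atTop (𝓝 (∫⁻ y, φ (f y) ∂μ)) :=
    lintegral_tendsto_of_tendsto_of_monotone
      (fun n => (h2.measurable.comp (g n).measurable).aemeasurable)
      (Eventually.of_forall fun y m n h => h1 (hmono y h))
      (Eventually.of_forall fun y => (h2.tendsto _).comp (hlim y))
  have hsimple (n) := hY.lintegral_negExp_simpleFunc (g n)
    (fun x => by
      rw [hg]
      by_cases h : x ∈ spanningSets Λ n
      · rw [Set.indicator_of_mem h]; exact (SimpleFunc.eapprox_lt_top f n x).ne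
      · simp [Set.indicator_of_notMem h])
    (fun c hc => by
      refine ((measure_mono fun x hx => ?_).trans_lt (measure_spanningSets_lt_top Λ n)).ne
      by_contra h
      exact hc (by rw [← (show g n x = c from hx), hg, Set.indicator_of_notMem h]))
  have hL : Tendsto (fun n => ∫⁻ ω, negExp (∑' i, g n (Y i ω)) ∂P) atTop
      (𝓝 (∫⁻ ω, negExp (∑' i, f (Y i ω)) ∂P)) := by
    refine tendsto_lintegral_of_dominated_convergence (fun _ => 1) (fun n => ?_) (fun n => ?_)
      (by simp) ?_
    · exact measurable_negExp.comp (Measurable.tsum fun i =>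
        (g n).measurable.comp (hY.measurable i))
    · exact Eventually.of_forall fun ω => negExp_le_one _
    · refine Eventually.of_forall fun ω => (continuous_negExp.tendsto _).comp ?_
      rw [← lintegral_sum_dirac hf]
      refine (hlim_lintegral _ (φ := id) monotone_id continuous_id).congr fun n => ?_
      exact lintegral_sum_dirac (g n).measurable
  refine tendsto_nhds_unique hL ?_
  simp_rw [hsimple]
  refine (continuous_negExp.tendsto _).comp (hlim_lintegral Λ (φ := fun x => 1 - negExp x) ?_ ?_)
  · intro x y h
    exact tsub_le_tsub_left (negExp_antitone h) _
  · exact (ENNReal.continuous_sub_left ENNReal.one_ne_top).comp continuous_negExp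

end Poisson

/-! ### The multivariate Mecke formula -/

open scoped Classical in
/-- The sum of `f (y l)` over the indices `l` that do not occur in the tuple `i`. -/
def restSum {k : ℕ} (i : Fin k → ℕ) (f : ℝ → ℝ≥0∞) (y : ℕ → ℝ) : ℝ≥0∞ :=
  ∑' l, if l ∈ Set.range i then 0 else f (y l)

open scoped Classical in
/-- The sum of `F i` over the tuples `i` of distinct indices. -/
def sumDistinct {k : ℕ} (F : (Fin k → ℕ) → ℝ≥0∞) : ℝ≥0∞ :=
  ∑' i : Fin k → ℕ, if Function.Injective i then F i else 0

open scoped Classical in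
lemma sumDistinct_succ {k : ℕ} (F : (Fin (k + 1) → ℕ) → ℝ≥0∞) :
    sumDistinct F = sumDistinct fun i : Fin k → ℕ =>
      ∑' l, if l ∈ Set.range i then 0 else F (Fin.cons l i) := by
  unfold sumDistinct
  rw [← (Fin.consEquiv fun _ : Fin (k + 1) => ℕ).tsum_eq]
  refine (ENNReal.tsum_prod (f := fun l i =>
    if Function.Injective (Fin.cons l i : Fin (k + 1) → ℕ) then F (Fin.cons l i) else 0)).trans ?_
  rw [ENNReal.tsum_comm]
  refine tsum_congr fun i => ?_
  simp_rw [Fin.cons_injective_iff]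
  split_ifs with hi
  · refine tsum_congr fun l => ?_
    by_cases hl : l ∈ Set.range i
    · rw [if_neg (fun h => h.1 hl), if_pos hl]
    · rw [if_pos ⟨hl, hi⟩, if_neg hl]
  · simp [hi]

lemma sumDistinct_zero (F : (Fin 0 → ℕ) → ℝ≥0∞) : sumDistinct F = F Fin.elim0 := by
  unfold sumDistinct
  rw [tsum_eq_single Fin.elim0 (fun i hi => (hi (Subsingleton.elim _ _)).elim),
    if_pos (Function.injective_of_subsingleton _)]

lemma sumDistinct_congr {k : ℕ} {F G : (Fin k → ℕ) → ℝ≥0∞}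
    (h : ∀ i, Function.Injective i → F i = G i) : sumDistinct F = sumDistinct G := by
  unfold sumDistinct
  refine tsum_congr fun i => ?_
  split_ifs with hi
  · exact h i hi
  · rfl

lemma sumDistinct_add {k : ℕ} (F G : (Fin k → ℕ) → ℝ≥0∞) :
    sumDistinct (fun i => F i + G i) = sumDistinct F + sumDistinct G := by
  unfold sumDistinct
  rw [← ENNReal.tsum_add]
  refine tsum_congr fun i => ?_
  split_ifs <;> simp

lemma sumDistinct_mul_right {k : ℕ} (F : (Fin k → ℕ) → ℝ≥0∞) (c : ℝ≥0∞) :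
    sumDistinct (fun i => F i * c) = sumDistinct F * c := by
  unfold sumDistinct
  rw [← ENNReal.tsum_mul_right]
  refine tsum_congr fun i => ?_
  split_ifs <;> simp

lemma sumDistinct_mono {k : ℕ} {F G : (Fin k → ℕ) → ℝ≥0∞} (h : ∀ i, F i ≤ G i) :
    sumDistinct F ≤ sumDistinct G := by
  unfold sumDistinct
  refine ENNReal.tsum_le_tsum fun i => ?_
  split_ifs
  · exact h i
  · rfl

lemma measurable_sumDistinct {α : Type*} [MeasurableSpace α] {k : ℕ} {F : α → (Fin k → ℕ) → ℝ≥0∞}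
    (h : ∀ i, Measurable fun a => F a i) : Measurable fun a => sumDistinct (F a) := by
  unfold sumDistinct
  refine Measurable.tsum fun i => ?_
  split_ifs
  · exact h i
  · exact measurable_const

lemma tendsto_sumDistinct {k : ℕ} {F : ℕ → (Fin k → ℕ) → ℝ≥0∞} {G : (Fin k → ℕ) → ℝ≥0∞}
    (hmono : ∀ i, Monotone fun m => F m i) (h : ∀ i, Tendsto (fun m => F m i) atTop (𝓝 (G i))) :
    Tendsto (fun m => sumDistinct (F m)) atTop (𝓝 (sumDistinct G)) := by
  unfold sumDistinct
  simp_rw [← lintegral_count]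
  refine lintegral_tendsto_of_tendsto_of_monotone
    (fun m => Measurable.of_discrete.aemeasurable)
    (Eventually.of_forall fun i m n hmn => ?_) (Eventually.of_forall fun i => ?_)
  · dsimp only
    split_ifs
    · exact hmono i hmn
    · rfl
  · split_ifs
    · exact h i
    · exact tendsto_const_nhds

lemma measurable_restSum {α : Type*} [MeasurableSpace α] {k : ℕ} (i : Fin k → ℕ) {f : ℝ → ℝ≥0∞}
    (hf : Measurable f) {y : α → ℕ → ℝ} (hy : ∀ l, Measurable fun a => y a l) :
    Measurable fun a => restSum i f (y a) := by
  unfold restSum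
  refine Measurable.tsum fun l => ?_
  split_ifs
  · exact measurable_const
  · exact hf.comp (hy l)

lemma restSum_add {k : ℕ} (i : Fin k → ℕ) (f g : ℝ → ℝ≥0∞) (y : ℕ → ℝ) :
    restSum i (fun x => f x + g x) y = restSum i f y + restSum i g y := by
  unfold restSum
  rw [← ENNReal.tsum_add]
  refine tsum_congr fun l => ?_
  split_ifs <;> simp

lemma restSum_div {k : ℕ} (i : Fin k → ℕ) (f : ℝ → ℝ≥0∞) (c : ℝ≥0∞) (y : ℕ → ℝ) :
    restSum i (fun x => f x / c) y = restSum i f y / c := by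
  unfold restSum
  simp_rw [ENNReal.div_eq_inv_mul]
  rw [← ENNReal.tsum_mul_left]
  refine tsum_congr fun l => ?_
  split_ifs <;> simp

lemma restSum_cons {k : ℕ} (i : Fin k → ℕ) {l : ℕ} (hl : l ∉ Set.range i) (f : ℝ → ℝ≥0∞)
    (y : ℕ → ℝ) :
    restSum i f y = f (y l) + restSum (Fin.cons l i : Fin (k + 1) → ℕ) f y := by
  classical
  unfold restSum
  rw [← tsum_ite_eq l (fun _ => f (y l)), ← ENNReal.tsum_add]
  refine tsum_congr fun l' => ?_
  by_cases h : l' = l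
  · subst h
    simp [Fin.range_cons, hl]
  · by_cases h' : l' ∈ Set.range i <;> simp_all [Fin.range_cons]

lemma restSum_zero (i : Fin 0 → ℕ) (f : ℝ → ℝ≥0∞) (y : ℕ → ℝ) :
    restSum i f y = ∑' l, f (y l) := by
  simp [restSum]

lemma negExp_add_expQuotient_div (m : ℕ) (b : ℝ≥0∞) :
    negExp (b / 2 ^ m) + expQuotient m b / 2 ^ m = 1 := by
  rw [expQuotient, mul_comm, mul_div_assoc, ENNReal.div_self (by simp) (by simp), mul_one,
    add_tsub_cancel_of_le (negExp_le_one _)]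

section Poisson

variable {Ω : Type*} [MeasurableSpace Ω] {P : Measure Ω} {Λ : Measure ℝ} {Y : ℕ → Ω → ℝ}

/-- The Mecke formula for products of functions of `k` distinct points and a Laplace functional of
the remaining points. -/
theorem IsPoissonProcess.lintegral_sumDistinct_prod [IsProbabilityMeasure P] [SigmaFinite Λ]
    (hY : IsPoissonProcess P Λ Y) (k : ℕ) (g : Fin k → ℝ → ℝ≥0) (hg : ∀ j, Measurable (g j))
    (hgi : ∀ j, ∫⁻ y, g j y ∂Λ ≠ ∞) (f : ℝ → ℝ≥0) (hf : Measurable f) :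
    ∫⁻ ω, sumDistinct (fun i : Fin k → ℕ => (∏ j, (g j (Y (i j) ω) : ℝ≥0∞)) *
        negExp (restSum i (fun y => f y) fun l => Y l ω)) ∂P
      = (∏ j, ∫⁻ y, g j y ∂Λ) * negExp (∫⁻ y, 1 - negExp (f y) ∂Λ) := by
  induction k generalizing f with
  | zero =>
    simp_rw [sumDistinct_zero, restSum_zero]
    simp [hY.lintegral_negExp hf.coe_nnreal_ennreal]
  | succ k ih =>
    have ihg := ih (fun j => g j.succ) (fun j => hg _) (fun j => hgi _)
    set G : (Fin k → ℕ) → Ω → ℝ≥0∞ := fun i ω => ∏ j : Fin k, (g j.succ (Y (i j) ω) : ℝ≥0∞)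
      with hG
    set p := ∏ j : Fin k, ∫⁻ y, g j.succ y ∂Λ with hp
    set a := ∫⁻ y, 1 - negExp (f y) ∂Λ with ha
    -- The direction in which the Laplace functional is differentiated. The factor `exp f` undoes
    -- the `exp (-f)` that the point removed from the remainder contributes.
    let u : ℝ → ℝ≥0 := fun y => g 0 y * Real.toNNReal (Real.exp (f y))
    have hu : Measurable u := by fun_prop
    have huf (y) : negExp (f y) * (u y : ℝ≥0∞) = g 0 y := by
      rw [negExp_coe, ENNReal.coe_mul, mul_left_comm, show
        ((Real.exp (f y)).toNNReal : ℝ≥0∞) = ENNReal.ofReal (Real.exp (f y)) from rfl,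
        ← ENNReal.ofReal_mul (Real.exp_nonneg _), ← Real.exp_add]
      simp
    let R (φ : ℝ → ℝ≥0) (i : Fin k → ℕ) (ω : Ω) := restSum i (fun y => (φ y : ℝ≥0∞)) fun l => Y l ω
    have hR (φ : ℝ → ℝ≥0) (hφ : Measurable φ) (i) : Measurable (R φ i) :=
      measurable_restSum i (by fun_prop) hY.measurable
    have hGm (i) : Measurable (G i) :=
      Finset.measurable_prod _ fun j _ => ((hg _).comp (hY.measurable _)).coe_nnreal_ennreal
    have hpoint (ω) : sumDistinct (fun i : Fin (k + 1) → ℕ => (∏ j, (g j (Y (i j) ω) : ℝ≥0∞)) *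
        negExp (restSum i (fun y => f y) fun l => Y l ω))
        = sumDistinct fun i => G i ω * (negExp (R f i ω) * R u i ω) := by
      rw [sumDistinct_succ]
      refine sumDistinct_congr fun i _ => ?_
      rw [show R u i ω = restSum i (fun y => (u y : ℝ≥0∞)) (fun l => Y l ω) from rfl, restSum,
        ← ENNReal.tsum_mul_left, ← ENNReal.tsum_mul_left]
      refine tsum_congr fun l => ?_
      split_ifs with hl
      · simp
      · rw [Fin.prod_univ_succ]
        simp only [Fin.cons_zero, Fin.cons_succ, R]
        rw [restSum_cons i hl (fun y => (f y : ℝ≥0∞)), negExp_add, ← huf (Y l ω)]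
        ring
    simp_rw [hpoint]
    -- `D m` is a difference quotient of the induction hypothesis at `f` in the direction `u`, with
    -- step `2 ^ (-m)`. It increases to the integral sought, while the right-hand side is computed
    -- exactly for each `m`.
    let D (m : ℕ) := ∫⁻ ω, sumDistinct (fun i => G i ω * (negExp (R f i ω) *
      expQuotient m (R u i ω))) ∂P
    let x (m : ℕ) := ∫⁻ y, negExp (f y) * expQuotient m (u y) ∂Λ
    have hDlim : Tendsto D atTop (𝓝 (∫⁻ ω, sumDistinct (fun i => G i ω * (negExp (R f i ω) *
        R u i ω)) ∂P)) := by
      have hm (ω i) : Monotone fun m => G i ω * (negExp (R f i ω) * expQuotient m (R u i ω)) := by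
        intro m n hmn
        dsimp only
        gcongr
        exact expQuotient_mono_left _ hmn
      refine lintegral_tendsto_of_tendsto_of_monotone (fun m => ?_)
        (Eventually.of_forall fun ω m n hmn => sumDistinct_mono fun i => hm ω i hmn)
        (Eventually.of_forall fun ω => tendsto_sumDistinct (hm ω) fun i => ?_)
      · refine (measurable_sumDistinct fun i => ?_).aemeasurable
        have := hR f hf i
        have := hR u hu i
        have := hGm i
        fun_prop
      · refine ENNReal.Tendsto.const_mul (ENNReal.Tendsto.const_mul (tendsto_expQuotient _)
          (Or.inr (negExp_ne_top _))) (Or.inr ?_)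
        exact ENNReal.prod_ne_top fun j _ => ENNReal.coe_ne_top
    have hxmono : Monotone x := fun m n hmn => lintegral_mono fun y => by
      dsimp only
      gcongr
      exact expQuotient_mono_left _ hmn
    have hxlim : Tendsto x atTop (𝓝 (∫⁻ y, g 0 y ∂Λ)) := by
      simp_rw [← huf]
      refine lintegral_tendsto_of_tendsto_of_monotone (fun m => by fun_prop)
        (Eventually.of_forall fun y m n hmn => ?_)
        (Eventually.of_forall fun y => ENNReal.Tendsto.const_mul (tendsto_expQuotient _)
          (Or.inr (negExp_ne_top _)))
      dsimp only
      gcongr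
      exact expQuotient_mono_left _ hmn
    have hpfin : p ≠ ∞ := ENNReal.prod_ne_top fun j _ => hgi _
    have hD (m) : D m = p * negExp a * expQuotient m (x m) := by
      -- The hypothesis is applied at `f` and at `f + u / 2 ^ m`. Subtracting the two identities
      -- isolates `D m / 2 ^ m`.
      let fm : ℝ → ℝ≥0 := fun y => f y + u y / 2 ^ m
      have hcoe (y) : (fm y : ℝ≥0∞) = f y + u y / 2 ^ m := by
        simp only [fm]
        rw [ENNReal.coe_add, ENNReal.coe_div (by positivity)]
        simp
      have hA := ihg f hf
      have hB := ihg fm (by fun_prop)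
      have hRfm (i ω) : R fm i ω = R f i ω + R u i ω / 2 ^ m := by
        simp only [R, hcoe]
        rw [restSum_add, restSum_div]
      have ham : ∫⁻ y, 1 - negExp (fm y) ∂Λ = a + x m / 2 ^ m := by
        rw [ha, ENNReal.div_eq_inv_mul, ← lintegral_const_mul _ (by fun_prop),
          ← lintegral_add_left (by fun_prop)]
        refine lintegral_congr fun y => ?_
        have h1 := negExp_add_expQuotient_div m (u y)
        rw [hcoe, negExp_add]
        refine ENNReal.sub_eq_of_eq_add (ENNReal.mul_ne_top (negExp_ne_top _) (negExp_ne_top _)) ?_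
        calc (1 : ℝ≥0∞) = (1 - negExp (f y)) + negExp (f y) * 1 := by
              rw [mul_one, tsub_add_cancel_of_le (negExp_le_one _)]
          _ = _ := by
              rw [← h1, ENNReal.div_eq_inv_mul (a := expQuotient m (u y)),
                mul_add, mul_left_comm, add_assoc]
              ring
      have hsplit : ∫⁻ ω, sumDistinct (fun i => G i ω * negExp (R f i ω)) ∂P
          = ∫⁻ ω, sumDistinct (fun i => G i ω * negExp (R fm i ω)) ∂P + D m / 2 ^ m := by
        simp only [D]
        rw [ENNReal.div_eq_inv_mul, mul_comm, ← lintegral_mul_const', ← lintegral_add_left]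
        · refine lintegral_congr fun ω => ?_
          rw [← sumDistinct_mul_right, ← sumDistinct_add]
          refine sumDistinct_congr fun i _ => ?_
          have h1 := negExp_add_expQuotient_div m (R u i ω)
          rw [hRfm, negExp_add]
          calc G i ω * negExp (R f i ω) = G i ω * (negExp (R f i ω) * 1) := by rw [mul_one]
            _ = _ := by
              rw [← h1, ENNReal.div_eq_inv_mul (a := expQuotient m (R u i ω))]
              ring
        · refine measurable_sumDistinct fun i => ?_
          exact (hGm i).mul (measurable_negExp.comp (hR fm (by fun_prop) i))
        · simp
      rw [hA, hB, ham, negExp_add] at hsplit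
      have h1 := negExp_add_expQuotient_div m (x m)
      have h2 : p * negExp a = p * (negExp a * negExp (x m / 2 ^ m))
          + p * negExp a * expQuotient m (x m) / 2 ^ m := by
        calc p * negExp a = p * negExp a * 1 := by rw [mul_one]
          _ = _ := by
            rw [← h1]
            simp only [ENNReal.div_eq_inv_mul]
            ring
      rw [h2] at hsplit
      -- Cancellation in `[0, ∞]` needs a finite summand. This is where finiteness of the integrals
      -- of the `g j` enters; `a` itself may be infinite.
      have h3 := (ENNReal.add_right_inj (ENNReal.mul_ne_top hpfin
        (ENNReal.mul_ne_top (negExp_ne_top _) (negExp_ne_top _)))).1 hsplit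
      have h4 := congrArg (· * (2 : ℝ≥0∞) ^ m) h3
      simpa [ENNReal.div_mul_cancel] using h4.symm
    refine tendsto_nhds_unique hDlim ?_
    rw [show D = _ from funext hD, Fin.prod_univ_succ, mul_comm (∫⁻ y, g 0 y ∂Λ), mul_right_comm]
    exact ENNReal.Tendsto.const_mul (tendsto_expQuotient_of_monotone hxmono hxlim)
      (Or.inr (ENNReal.mul_ne_top hpfin (negExp_ne_top _)))

end Poisson

/-! ### Uniqueness of the Laplace transform -/

/-- A bounded injective continuous extension of `exp (-x)`, `x ≥ 0`, to the real line. -/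
def expDecay : BoundedContinuousFunction ℝ ℝ :=
  BoundedContinuousFunction.ofNormedAddCommGroup
    (fun x => if 0 ≤ x then Real.exp (-x) else 2 - Real.exp x)
    (Continuous.if_le (by fun_prop) (by fun_prop) continuous_const continuous_id
      (fun x hx => by norm_num [← hx])) 2 (fun x => by
      have h1 := Real.exp_pos x
      have h2 := Real.exp_pos (-x)
      rw [Real.norm_eq_abs, abs_le]
      split_ifs with h
      · have : Real.exp (-x) ≤ 1 := Real.exp_le_one_iff.2 (by linarith)
        constructor <;> linarith
      · have : Real.exp x ≤ 1 := Real.exp_le_one_iff.2 (by linarith)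
        constructor <;> linarith)

lemma expDecay_apply (x : ℝ) :
    expDecay x = if 0 ≤ x then Real.exp (-x) else 2 - Real.exp x := rfl

lemma expDecay_injective : Function.Injective expDecay := by
  have hanti : StrictAnti expDecay := by
    intro x y hxy
    rw [expDecay_apply, expDecay_apply]
    have hexp := Real.exp_lt_exp.2 hxy
    split_ifs with hy hx hx
    · exact Real.exp_lt_exp.2 (by linarith)
    · have h1 : Real.exp x < 1 := by simpa using hx
      have h2 : Real.exp (-y) ≤ 1 := Real.exp_le_one_iff.2 (by linarith)
      linarith
    · linarith
    · linarith
  exact hanti.injective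

/-- Finite measures on `[0, ∞)` with the same Laplace transform are equal. -/
theorem ext_of_lintegral_exp {μ ν : Measure ℝ} [IsFiniteMeasure μ] [IsFiniteMeasure ν]
    (hμ : ∀ᵐ x ∂μ, 0 ≤ x) (hν : ∀ᵐ x ∂ν, 0 ≤ x)
    (h : ∀ n : ℕ, ∫⁻ x, ENNReal.ofReal (Real.exp (-(n * x))) ∂μ
      = ∫⁻ x, ENNReal.ofReal (Real.exp (-(n * x))) ∂ν) : μ = ν := by
  -- Polynomials in `expDecay` separate points of the line, and on `[0, ∞)` the powers of `expDecay`
  -- are `exp (-n x)`. Hence Laplace transforms at natural numbers suffice.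
  let A : StarSubalgebra ℝ (BoundedContinuousFunction ℝ ℝ) :=
    { (aeval expDecay : ℝ[X] →ₐ[ℝ] BoundedContinuousFunction ℝ ℝ).range with
      star_mem' := fun {a} ha => by
        have : star a = a := by ext x; simp
        rwa [this] }
  have hpow (ρ : Measure ℝ) (hρ : ∀ᵐ x ∂ρ, 0 ≤ x) (n : ℕ) : ∫ x, (expDecay x) ^ n ∂ρ
      = (∫⁻ x, ENNReal.ofReal (Real.exp (-(n * x))) ∂ρ).toReal := by
    rw [← integral_eq_lintegral_of_nonneg_ae (Eventually.of_forall fun x => (Real.exp_pos _).le)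
      (by fun_prop)]
    refine integral_congr_ae ?_
    filter_upwards [hρ] with x hx
    rw [expDecay_apply, if_pos hx, ← Real.exp_nat_mul]
    ring_nf
  refine ext_of_forall_mem_subalgebra_integral_eq_of_polish (𝕜 := ℝ) (A := A) ?_ ?_
  · intro x y hxy
    refine ⟨expDecay, ⟨expDecay.toContinuousMap, ⟨expDecay, ⟨X, by simp⟩, rfl⟩, rfl⟩, ?_⟩
    exact fun h => hxy (expDecay_injective h)
  · rintro _ ⟨p, rfl⟩
    have hint (ρ : Measure ℝ) [IsFiniteMeasure ρ] (f : BoundedContinuousFunction ℝ ℝ) :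
      Integrable f ρ := f.integrable ρ
    have hlin (ρ : Measure ℝ) [IsFiniteMeasure ρ] (hρ : ∀ᵐ x ∂ρ, 0 ≤ x) :
        ∫ x, (aeval expDecay p : BoundedContinuousFunction ℝ ℝ) x ∂ρ
        = ∑ n ∈ p.support, p.coeff n *
          (∫⁻ x, ENNReal.ofReal (Real.exp (-(n * x))) ∂ρ).toReal := by
      simp_rw [← hpow ρ hρ, ← integral_const_mul]
      rw [← integral_finsetSum]
      · refine integral_congr_ae (Eventually.of_forall fun x => ?_)
        simp [aeval_def, eval₂_eq_sum, Polynomial.sum, BoundedContinuousFunction.coe_sum]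
      · intro n _
        exact ((expDecay ^ n).integrable ρ).const_mul _
    simp only [AlgHom.toRingHom_eq_coe, RingHom.coe_coe]
    rw [hlin μ hμ, hlin ν hν]
    simp_rw [h]

/-! ### The intensity measure and the Gamma distribution -/

lemma lintegral_gammaIntensity (θ : ℝ) {f : ℝ → ℝ≥0∞} (hf : Measurable f) :
    ∫⁻ y, f y ∂(gammaIntensity θ)
      = ∫⁻ y in Set.Ioi 0, ENNReal.ofReal (θ * y⁻¹ * Real.exp (-y)) * f y := by
  rw [gammaIntensity, lintegral_withDensity_eq_lintegral_mul _ (by fun_prop) hf]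
  rfl

instance sigmaFinite_gammaIntensity (θ : ℝ) : SigmaFinite (gammaIntensity θ) := by
  unfold gammaIntensity
  exact SigmaFinite.withDensity_ofReal _

lemma lintegral_exp_neg_mul {r : ℝ} (hr : 0 < r) {θ : ℝ} (hθ : 0 ≤ θ) :
    ∫⁻ y in Set.Ioi 0, ENNReal.ofReal (θ * Real.exp (-(r * y))) = ENNReal.ofReal (θ / r) := by
  have h := integrableOn_exp_mul_Ioi (a := -r) (by linarith) 0
  have h2 := integral_exp_mul_Ioi (a := -r) (by linarith) 0
  rw [← ofReal_integral_eq_lintegral_ofReal]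
  · rw [integral_const_mul]
    simp_rw [← neg_mul]
    rw [h2]
    simp [div_eq_mul_inv]
  · simp_rw [← neg_mul]
    exact h.const_mul θ
  · exact Eventually.of_forall fun y => by positivity

/-- A Frullani integral: `y⁻¹ (exp (-y) - exp (-(1 + n) y))` is the integral of `exp (-(1 + s) y)`
over `0 < s ≤ n`. Tonelli then leaves the integral of `θ / (1 + s)`. -/
lemma lintegral_one_sub_negExp_gammaIntensity {θ : ℝ} (hθ : 0 < θ) (n : ℕ) :
    ∫⁻ y, 1 - negExp ((n * y.toNNReal : ℝ≥0) : ℝ≥0∞) ∂(gammaIntensity θ)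
      = ENNReal.ofReal (θ * Real.log (1 + n)) := by
  have hn : (0 : ℝ) ≤ n := n.cast_nonneg
  rw [lintegral_gammaIntensity θ (by fun_prop)]
  have h1 (y : ℝ) (hy : y ∈ Set.Ioi (0 : ℝ)) : ENNReal.ofReal (θ * y⁻¹ * Real.exp (-y)) *
      (1 - negExp ((n * y.toNNReal : ℝ≥0) : ℝ≥0∞))
      = ∫⁻ s in Set.Ioc 0 (n : ℝ), ENNReal.ofReal (θ * Real.exp (-((1 + s) * y))) := by
    have hy : 0 < y := hy
    rw [negExp_coe, ← ENNReal.ofReal_one, ← ENNReal.ofReal_sub _ (Real.exp_nonneg _),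
      ← ENNReal.ofReal_mul (by positivity), ← ofReal_integral_eq_lintegral_ofReal,
      ← intervalIntegral.integral_of_le hn]
    · congr 1
      have hd (s : ℝ) : HasDerivAt (fun s => -(θ * y⁻¹ * Real.exp (-((1 + s) * y))))
          (θ * Real.exp (-((1 + s) * y))) s := by
        have := (((((hasDerivAt_id s).const_add 1).mul_const y).neg.exp).const_mul (θ * y⁻¹)).neg
        convert! this using 1
        field_simp
        simp [mul_comm]
      rw [intervalIntegral.integral_eq_sub_of_hasDerivAt (fun s _ => hd s)
        (Continuous.intervalIntegrable (by fun_prop) _ _)]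
      simp only [NNReal.coe_mul, NNReal.coe_natCast, Real.coe_toNNReal _ hy.le]
      rw [show -((1 + (n : ℝ)) * y) = -y + -(n * y) by ring, Real.exp_add]
      simp
      ring
    · exact (Continuous.integrableOn_Ioc (by fun_prop))
    · exact Eventually.of_forall fun s => by positivity
  rw [setLIntegral_congr_fun measurableSet_Ioi h1, lintegral_lintegral_swap (by fun_prop)]
  have h2 (s : ℝ) (hs : s ∈ Set.Ioc 0 (n : ℝ)) :
      ∫⁻ y in Set.Ioi 0, ENNReal.ofReal (θ * Real.exp (-((1 + s) * y)))
      = ENNReal.ofReal (θ / (1 + s)) := lintegral_exp_neg_mul (by linarith [hs.1]) hθ.le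
  rw [setLIntegral_congr_fun measurableSet_Ioc h2]
  have hcont : ContinuousOn (fun s : ℝ => θ / (1 + s)) (Set.uIcc 0 (n : ℝ)) := by
    refine continuousOn_const.div (by fun_prop) fun s hs => ?_
    rw [Set.uIcc_of_le hn] at hs
    linarith [hs.1]
  rw [← ofReal_integral_eq_lintegral_ofReal, ← intervalIntegral.integral_of_le hn]
  · congr 1
    rw [intervalIntegral.integral_eq_sub_of_hasDerivAt (f := fun s => θ * Real.log (1 + s))
      (fun s hs => ?_) hcont.intervalIntegrable]
    · simp
    · rw [Set.uIcc_of_le hn] at hs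
      have := (((hasDerivAt_id s).const_add 1).log (by simp; linarith [hs.1])).const_mul θ
      simpa [div_eq_mul_inv] using this
  · exact (intervalIntegrable_iff_integrableOn_Ioc_of_le hn).1 hcont.intervalIntegrable
  · refine (ae_restrict_iff' measurableSet_Ioc).2 (Eventually.of_forall fun s hs => ?_)
    have := hs.1
    positivity

lemma negExp_lintegral_gammaIntensity {θ : ℝ} (hθ : 0 < θ) (n : ℕ) :
    negExp (∫⁻ y, 1 - negExp ((n * y.toNNReal : ℝ≥0) : ℝ≥0∞) ∂(gammaIntensity θ))
      = ENNReal.ofReal ((1 + n) ^ (-θ)) := by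
  have hlog : 0 ≤ Real.log (1 + n) := Real.log_nonneg (by linarith [n.cast_nonneg (α := ℝ)])
  rw [lintegral_one_sub_negExp_gammaIntensity hθ, negExp_ofReal (by positivity),
    Real.rpow_def_of_pos (by positivity)]
  ring_nf

lemma ae_pos_gammaMeasure (θ : ℝ) : ∀ᵐ x ∂(gammaMeasure θ 1), 0 < x := by
  rw [ae_iff]
  simp_rw [not_lt]
  change gammaMeasure θ 1 (Set.Iic 0) = 0
  rw [gammaMeasure, withDensity_apply _ measurableSet_Iic,
    ← setLIntegral_congr (Iio_ae_eq_Iic (a := (0 : ℝ)))]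
  exact lintegral_gammaPDF_of_nonpos le_rfl

lemma lintegral_exp_gammaMeasure {θ : ℝ} (hθ : 0 < θ) (n : ℕ) :
    ∫⁻ x, ENNReal.ofReal (Real.exp (-(n * x))) ∂(gammaMeasure θ 1)
      = ENNReal.ofReal ((1 + n) ^ (-θ)) := by
  rw [gammaMeasure, lintegral_withDensity_eq_lintegral_mul _ (f := gammaPDF θ 1)
    (measurable_gammaPDFReal θ 1).ennreal_ofReal (by fun_prop)]
  have hn : (0 : ℝ) < 1 + n := by positivity
  -- The factor `exp (-n x)` turns the density of rate `1` into a multiple of the Gamma density of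
  -- rate `1 + n`.
  calc _ = ∫⁻ x, ENNReal.ofReal ((1 + n) ^ (-θ)) * gammaPDF θ (1 + n) x := by
        refine lintegral_congr fun x => ?_
        simp only [Pi.mul_apply]
        rcases lt_or_ge x 0 with hx | hx
        · simp [gammaPDF_of_neg hx]
        · rw [gammaPDF_of_nonneg hx, gammaPDF_of_nonneg hx,
            ← ENNReal.ofReal_mul (by positivity), ← ENNReal.ofReal_mul (by positivity)]
          congr 1
          rw [Real.rpow_neg hn.le, show -((1 + (n : ℝ)) * x) = -(1 * x) + -(n * x) by ring,
            Real.exp_add]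
          have := (Real.rpow_pos_of_pos hn θ).ne'
          field_simp
          simp
    _ = _ := by
        rw [lintegral_const_mul _ (f := gammaPDF θ (1 + n))
            (measurable_gammaPDFReal θ _).ennreal_ofReal,
          lintegral_gammaPDF_eq_one hθ hn, mul_one]

/-! ### The Mecke formula for a Gamma process -/

section Poisson

variable {Ω : Type*} [MeasurableSpace Ω] {P : Measure Ω} [IsProbabilityMeasure P]
  {Y : ℕ → Ω → ℝ}

/-- Campbell's formula. -/
lemma IsPoissonProcess.lintegral_tsum {Λ : Measure ℝ} [SigmaFinite Λ] (hY : IsPoissonProcess P Λ Y)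
    {g : ℝ → ℝ≥0} (hg : Measurable g) (hgi : ∫⁻ y, g y ∂Λ ≠ ∞) :
    ∫⁻ ω, ∑' l, (g (Y l ω) : ℝ≥0∞) ∂P = ∫⁻ y, g y ∂Λ := by
  have h := hY.lintegral_sumDistinct_prod 1 (fun _ => g) (fun _ => hg) (fun _ => hgi) (fun _ => 0)
    measurable_const
  simp_rw [sumDistinct_succ, sumDistinct_zero] at h
  simpa [restSum] using h

variable {θ : ℝ}

/-- By Campbell's formula the expected number of points in `(-∞, 0]` is its intensity, which is
zero. -/
lemma IsPoissonProcess.ae_pos (hY : IsPoissonProcess P (gammaIntensity θ) Y) :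
    ∀ᵐ ω ∂P, ∀ l, 0 < Y l ω := by
  have hmeas : Measurable
      fun y => (((Set.Iic (0 : ℝ)).indicator (fun _ => 1) y : ℝ≥0) : ℝ≥0∞) :=
    (measurable_const.indicator measurableSet_Iic).coe_nnreal_ennreal
  have h0 : ∫⁻ y, (((Set.Iic (0 : ℝ)).indicator (fun _ => 1) y : ℝ≥0) : ℝ≥0∞) ∂(gammaIntensity θ)
      = 0 := by
    rw [lintegral_gammaIntensity θ hmeas]
    refine (setLIntegral_congr_fun measurableSet_Ioi fun y hy => ?_).trans lintegral_zero
    have : y ∉ Set.Iic (0 : ℝ) := by simpa using hy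
    simp [Set.indicator_of_notMem this]
  have h := hY.lintegral_tsum (g := (Set.Iic (0 : ℝ)).indicator fun _ => 1)
    (measurable_const.indicator measurableSet_Iic) (by rw [h0]; simp)
  rw [h0, lintegral_eq_zero_iff (Measurable.tsum fun l => by exact hmeas.comp (hY.measurable l))] at h
  filter_upwards [h] with ω hω l
  simp only [Pi.zero_apply, ENNReal.tsum_eq_zero, ENNReal.coe_eq_zero,
    Set.indicator_apply_eq_zero, one_ne_zero, imp_false, Set.mem_Iic, not_le] at hω
  exact hω l

lemma IsPoissonProcess.ae_tsum_ne_top (hθ : 0 < θ) (hY : IsPoissonProcess P (gammaIntensity θ) Y) :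
    ∀ᵐ ω ∂P, ∑' l, ENNReal.ofReal (Y l ω) ≠ ∞ := by
  have h0 : ∫⁻ y, (y.toNNReal : ℝ≥0∞) ∂(gammaIntensity θ) = ENNReal.ofReal θ := by
    rw [lintegral_gammaIntensity θ (by fun_prop)]
    have h := lintegral_exp_neg_mul one_pos hθ.le
    rw [div_one] at h
    rw [← h]
    refine setLIntegral_congr_fun measurableSet_Ioi fun y hy => ?_
    have hy : 0 < y := hy
    rw [show (y.toNNReal : ℝ≥0∞) = ENNReal.ofReal y from rfl,
      ← ENNReal.ofReal_mul (by positivity)]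
    congr 1
    field_simp
  have h := hY.lintegral_tsum (g := Real.toNNReal) (by fun_prop) (by simp [h0])
  refine (ae_lt_top (Measurable.tsum fun l => (hY.measurable l).ennreal_ofReal) ?_).mono
    fun ω h => h.ne
  exact h.trans_ne (by simp [h0])

lemma restSum_ofReal_le {k : ℕ} (i : Fin k → ℕ) (y : ℕ → ℝ) :
    restSum i ENNReal.ofReal y ≤ ∑' l, ENNReal.ofReal (y l) := by
  unfold restSum
  refine ENNReal.tsum_le_tsum fun l => ?_
  split_ifs <;> simp

open scoped Classical in
/-- The Mecke formula for `k` distinct points of a Gamma process and the sum of the remaining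
points. -/
theorem IsPoissonProcess.lintegral_sumDistinct (hθ : 0 < θ)
    (hY : IsPoissonProcess P (gammaIntensity θ) Y) {k : ℕ} {F : (Fin k → ℝ) × ℝ → ℝ≥0∞}
    (hF : Measurable F) :
    ∫⁻ ω, sumDistinct (fun i : Fin k → ℕ => F (fun j => Y (i j) ω,
        (restSum i ENNReal.ofReal fun l => Y l ω).toReal)) ∂P
      = ∫⁻ x, ∫⁻ w, F (x, w) ∂(gammaMeasure θ 1) ∂(Measure.pi fun _ => gammaIntensity θ) := by
  have : IsProbabilityMeasure (gammaMeasure θ 1) := isProbabilityMeasure_gammaMeasure hθ one_pos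
  let T (i : Fin k → ℕ) (ω : Ω) : (Fin k → ℝ) × ℝ :=
    (fun j => Y (i j) ω, (restSum i ENNReal.ofReal fun l => Y l ω).toReal)
  have hT (i) : Measurable (T i) := (measurable_pi_lambda _ fun j => hY.measurable _).prodMk
    (measurable_restSum i ENNReal.measurable_ofReal hY.measurable).ennreal_toReal
  -- The Campbell measure of `k` distinct points together with the sum of the others. The claim is
  -- that it is a product measure, and this is tested on boxes with sides of finite intensity.
  let M : Measure ((Fin k → ℝ) × ℝ) := Measure.sum fun i : Fin k → ℕ =>
    if Function.Injective i then P.map (T i) else 0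
  have hM {G : (Fin k → ℝ) × ℝ → ℝ≥0∞} (hG : Measurable G) :
      ∫⁻ z, G z ∂M = ∫⁻ ω, sumDistinct (fun i => G (T i ω)) ∂P := by
    unfold sumDistinct
    rw [lintegral_sum_measure, MeasureTheory.lintegral_tsum]
    · refine tsum_congr fun i => ?_
      split_ifs
      · rw [lintegral_map hG (hT i)]
      · simp
    · intro i
      split_ifs
      · exact (hG.comp (hT i)).aemeasurable
      · exact aemeasurable_const
  suffices hprod : (Measure.pi fun _ : Fin k => gammaIntensity θ).prod (gammaMeasure θ 1) = M by
    rw [← lintegral_prod _ hF.aemeasurable, hprod, hM hF]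
  let C : Set (Set ℝ) := {s | MeasurableSet s ∧ gammaIntensity θ s ≠ ∞}
  have hC : IsPiSystem C := fun s hs t ht _ =>
    ⟨hs.1.inter ht.1, ne_top_of_le_ne_top hs.2 (measure_mono Set.inter_subset_left)⟩
  let hCfin : (gammaIntensity θ).FiniteSpanningSetsIn C :=
    { set := spanningSets (gammaIntensity θ)
      set_mem := fun n => ⟨measurableSet_spanningSets _ n, (measure_spanningSets_lt_top _ n).ne⟩
      finite := fun n => measure_spanningSets_lt_top _ n
      spanning := iUnion_spanningSets _ }
  have hCgen : MeasurableSpace.generateFrom C = (inferInstance : MeasurableSpace ℝ) := by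
    refine le_antisymm (MeasurableSpace.generateFrom_le fun s hs => hs.1) fun s hs => ?_
    rw [← Set.inter_univ s, ← iUnion_spanningSets (gammaIntensity θ), Set.inter_iUnion]
    refine MeasurableSet.iUnion fun n => MeasurableSpace.measurableSet_generateFrom ?_
    exact ⟨hs.inter (measurableSet_spanningSets _ n), ne_top_of_le_ne_top
      (measure_spanningSets_lt_top _ n).ne (measure_mono Set.inter_subset_right)⟩
  refine Measure.prod_eq_generateFrom (C := Set.pi Set.univ '' Set.pi Set.univ fun _ => C)
    (D := {t | MeasurableSet t}) ?_ MeasurableSpace.generateFrom_measurableSet (IsPiSystem.pi fun _ => hC)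
    MeasurableSpace.isPiSystem_measurableSet
    (Measure.FiniteSpanningSetsIn.pi fun _ => hCfin) (Measure.toFiniteSpanningSetsIn _) ?_
  · exact generateFrom_eq_pi (fun _ => hCgen) fun _ => hCfin.isCountablySpanning
  · rintro _ ⟨s, hs, rfl⟩ t (ht : MeasurableSet t)
    have hs (j) : MeasurableSet (s j) ∧ gammaIntensity θ (s j) ≠ ∞ := hs j (Set.mem_univ j)
    have hB : MeasurableSet (Set.pi Set.univ s) := MeasurableSet.univ_pi fun j => (hs j).1
    rw [Measure.pi_pi]
    set p := ∏ j, gammaIntensity θ (s j)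
    have hp : p ≠ ∞ := ENNReal.prod_ne_top fun j _ => (hs j).2
    -- With the box for the `k` points fixed, `ρ` is the resulting measure of the remaining sum. Its
    -- Laplace transform is `p` times that of Gamma(`θ`), which identifies it.
    let ρ : Measure ℝ := (M.restrict (Prod.fst ⁻¹' Set.pi Set.univ s)).map Prod.snd
    have hρ {G : ℝ → ℝ≥0∞} (hG : Measurable G) : ∫⁻ w, G w ∂ρ
        = ∫⁻ ω, sumDistinct (fun i => (∏ j, (((s j).indicator (fun _ => 1) (Y (i j) ω) : ℝ≥0) : ℝ≥0∞))
          * G ((restSum i ENNReal.ofReal fun l => Y l ω).toReal)) ∂P := by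
      rw [lintegral_map hG measurable_snd, ← lintegral_indicator (measurable_fst hB),
        hM (G := (Prod.fst ⁻¹' Set.pi Set.univ s).indicator fun a => G a.2)
          ((hG.comp measurable_snd).indicator (measurable_fst hB))]
      refine lintegral_congr fun ω => sumDistinct_congr fun i _ => ?_
      by_cases h : ∀ j, Y (i j) ω ∈ s j
      · rw [Set.indicator_of_mem (by simpa [T] using h)]
        simp [Set.indicator_of_mem (h _), T]
      · rw [Set.indicator_of_notMem (by simpa [T] using h)]
        push Not at h
        obtain ⟨j, hj⟩ := h
        rw [Finset.prod_eq_zero (Finset.mem_univ j) (by simp [Set.indicator_of_notMem hj]), zero_mul]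
    have hlap (n : ℕ) : ∫⁻ w, ENNReal.ofReal (Real.exp (-(n * w))) ∂ρ
        = p * ENNReal.ofReal ((1 + n) ^ (-θ)) := by
      rw [hρ (by fun_prop), ← negExp_lintegral_gammaIntensity hθ]
      have h1 (j) : ∫⁻ y, (((s j).indicator (fun _ => 1) y : ℝ≥0) : ℝ≥0∞) ∂(gammaIntensity θ)
          = gammaIntensity θ (s j) := by
        rw [← lintegral_indicator_one (hs j).1]
        refine lintegral_congr fun y => ?_
        by_cases hy : y ∈ s j <;> simp [hy]
      have h := hY.lintegral_sumDistinct_prod k (fun j => (s j).indicator fun _ => 1)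
        (fun j => measurable_const.indicator (hs j).1) (fun j => by rw [h1]; exact (hs j).2)
        (fun y => n * y.toNNReal) (by fun_prop)
      simp_rw [h1] at h
      rw [← h]
      refine lintegral_congr_ae ?_
      filter_upwards [hY.ae_tsum_ne_top hθ] with ω hω
      refine sumDistinct_congr fun i _ => ?_
      have hfin := ne_top_of_le_ne_top hω (restSum_ofReal_le i _)
      have h2 : restSum i (fun y => ((n * y.toNNReal : ℝ≥0) : ℝ≥0∞)) (fun l => Y l ω)
          = ENNReal.ofReal (n * (restSum i ENNReal.ofReal fun l => Y l ω).toReal) := by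
        rw [ENNReal.ofReal_mul (by positivity), ENNReal.ofReal_toReal hfin, restSum, restSum,
          ← ENNReal.tsum_mul_left]
        refine tsum_congr fun l => ?_
        split_ifs <;> simp [ENNReal.ofReal]
      rw [h2, negExp_ofReal (by positivity)]
    have hρfin : IsFiniteMeasure ρ := by
      have := hlap 0
      simp only [Nat.cast_zero, zero_mul, neg_zero, Real.exp_zero, ENNReal.ofReal_one,
        lintegral_one, add_zero, Real.one_rpow, mul_one] at this
      exact ⟨by rw [this]; exact hp.lt_top⟩
    have hpfin : IsFiniteMeasure (p • gammaMeasure θ 1) := by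
      exact ⟨by simpa using hp.lt_top⟩
    have hρeq : ρ = p • gammaMeasure θ 1 := by
      refine ext_of_lintegral_exp ?_ ?_ fun n => ?_
      · rw [ae_iff]
        simp_rw [not_le]
        change ρ (Set.Iio 0) = 0
        rw [← lintegral_indicator_one measurableSet_Iio,
          hρ (measurable_one.indicator measurableSet_Iio)]
        refine (lintegral_congr fun ω => ?_).trans lintegral_zero
        unfold sumDistinct
        simp
      · exact Measure.ae_smul_measure ((ae_pos_gammaMeasure θ).mono fun x hx => hx.le) p
      · rw [hlap, lintegral_smul_measure, lintegral_exp_gammaMeasure hθ, smul_eq_mul]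
    have : M (Set.pi Set.univ s ×ˢ t) = ρ t := by
      rw [Measure.map_apply measurable_snd ht, Measure.restrict_apply (measurable_snd ht)]
      congr 1
      ext z
      simp [and_comm]
    rw [this, hρeq]
    rfl

end Poisson

/-! ### Beta-Gamma algebra -/

lemma lintegral_gammaMeasure (θ : ℝ) {f : ℝ → ℝ≥0∞} (hf : Measurable f) :
    ∫⁻ x, f x ∂(gammaMeasure θ 1) = ∫⁻ x, (Set.Ioi (0 : ℝ)).indicator (fun x =>
      ENNReal.ofReal ((Real.Gamma θ)⁻¹ * (x ^ (θ - 1) * Real.exp (-x))) * f x) x := by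
  rw [gammaMeasure, lintegral_withDensity_eq_lintegral_mul _ (f := gammaPDF θ 1)
    (measurable_gammaPDFReal θ 1).ennreal_ofReal hf]
  refine lintegral_congr_ae ?_
  filter_upwards [Measure.ae_ne volume 0] with x hx
  rcases lt_or_gt_of_ne hx with hx | hx
  · rw [Set.indicator_of_notMem (by simpa using hx.le), Pi.mul_apply, gammaPDF_of_neg hx, zero_mul]
  · rw [Set.indicator_of_mem (by simpa using hx), Pi.mul_apply, gammaPDF_of_nonneg hx.le]
    simp [mul_assoc]

lemma lintegral_betaMeasure {θ : ℝ} (hθ : 0 < θ) {f : ℝ → ℝ≥0∞} (hf : Measurable f) :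
    ∫⁻ x, f x ∂(betaMeasure 1 θ) = ∫⁻ x, (Set.Ioo (0 : ℝ) 1).indicator (fun x =>
      ENNReal.ofReal (θ * (1 - x) ^ (θ - 1)) * f x) x := by
  rw [betaMeasure, lintegral_withDensity_eq_lintegral_mul _ (f := betaPDF 1 θ)
    (measurable_betaPDFReal 1 θ).ennreal_ofReal hf]
  refine lintegral_congr fun x => ?_
  have hb : 1 / beta 1 θ = θ := by
    have := (Real.Gamma_pos_of_pos hθ).ne'
    rw [beta, add_comm, Real.Gamma_add_one hθ.ne', Real.Gamma_one]
    field_simp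
  by_cases hx : x ∈ Set.Ioo (0 : ℝ) 1
  · rw [Set.indicator_of_mem hx, Pi.mul_apply, betaPDF_of_pos_lt_one hx.1 hx.2, hb]
    simp
  · rw [Set.indicator_of_notMem hx, Pi.mul_apply, betaPDF, betaPDFReal,
      if_neg (by simpa using hx)]
    simp

lemma lintegral_comp_mul_left {t : ℝ} (ht : 0 < t) {f : ℝ → ℝ≥0∞} (hf : Measurable f) :
    ∫⁻ x, f x = ENNReal.ofReal t * ∫⁻ v, f (t * v) := by
  conv_lhs => rw [← Real.smul_map_volume_mul_left ht.ne']
  rw [lintegral_smul_measure, lintegral_map hf (by fun_prop), abs_of_pos ht, smul_eq_mul]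

/-- If `x` has intensity `θ x⁻¹ exp (-x) dx` and `s` is Gamma distributed then, under the
measure weighted by `x / (x + s)`, the variables `x + s` and `x / (x + s)` are independent with
Gamma and Beta distributions. -/
lemma lintegral_gammaIntensity_gammaMeasure {θ : ℝ} (hθ : 0 < θ) {G : ℝ × ℝ → ℝ≥0∞}
    (hG : Measurable G) :
    ∫⁻ x, ∫⁻ s, ENNReal.ofReal (x / (x + s)) * G (x + s, x / (x + s)) ∂(gammaMeasure θ 1)
        ∂(gammaIntensity θ)
      = ∫⁻ t, ∫⁻ v, G (t, v) ∂(betaMeasure 1 θ) ∂(gammaMeasure θ 1) := by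
  have : IsProbabilityMeasure (gammaMeasure θ 1) := isProbabilityMeasure_gammaMeasure hθ one_pos
  have : IsProbabilityMeasure (betaMeasure 1 θ) := isProbabilityMeasureBeta one_pos hθ
  have hΓ := Real.Gamma_pos_of_pos hθ
  have hc0 : 0 < (Real.Gamma θ)⁻¹ := inv_pos.2 hΓ
  -- The density in `(x, t)` with `t = x + s`. The size-biasing weight `x / t` cancels the singular
  -- factor `x⁻¹` of the intensity, and `exp (-x) exp (-s) = exp (-t)`. The substitution `x = t v`
  -- then separates the variables.
  let K : ℝ × ℝ → ℝ≥0∞ := fun p => {p : ℝ × ℝ | 0 < p.1 ∧ p.1 < p.2}.indicator (fun p =>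
    ENNReal.ofReal (θ * (Real.Gamma θ)⁻¹ * Real.exp (-p.2) * (p.2 - p.1) ^ (θ - 1) / p.2) * G (p.2, p.1 / p.2)) p
  have hK : Measurable K := by
    refine Measurable.indicator (by fun_prop) ?_
    exact (measurableSet_lt measurable_const measurable_fst).inter
      (measurableSet_lt measurable_fst measurable_snd)
  have hleft : ∫⁻ x, ∫⁻ s, ENNReal.ofReal (x / (x + s)) * G (x + s, x / (x + s)) ∂(gammaMeasure θ 1)
        ∂(gammaIntensity θ) = ∫⁻ x, ∫⁻ t, K (x, t) := by
    rw [lintegral_gammaIntensity θ (Measurable.lintegral_prod_right' (f := fun p : ℝ × ℝ =>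
      ENNReal.ofReal (p.1 / (p.1 + p.2)) * G (p.1 + p.2, p.1 / (p.1 + p.2))) (by fun_prop)),
      ← lintegral_indicator measurableSet_Ioi]
    refine lintegral_congr fun x => ?_
    by_cases hx : 0 < x
    · rw [Set.indicator_of_mem (by simpa using hx), lintegral_gammaMeasure θ (by fun_prop),
        ← lintegral_const_mul' _ _ (by simp), ← lintegral_sub_right_eq_self _ x]
      refine lintegral_congr fun t => ?_
      simp only [K]
      by_cases ht : x < t
      · have ht0 : 0 < t := hx.trans ht
        have htx : 0 < t - x := sub_pos.2 ht
        rw [Set.indicator_of_mem (by simpa using ht), Set.indicator_of_mem (by exact ⟨hx, ht⟩),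
          show x + (t - x) = t by ring, ← mul_assoc, ← mul_assoc,
          ← ENNReal.ofReal_mul (by positivity), ← ENNReal.ofReal_mul (by positivity)]
        congr 2
        rw [show -t = -x + -(t - x) by ring, Real.exp_add]
        field_simp
      · rw [Set.indicator_of_notMem (by simpa using ht), Set.indicator_of_notMem (fun h => ht h.2),
          mul_zero]
    · rw [Set.indicator_of_notMem (by simpa using hx)]
      refine (lintegral_zero.symm.trans (lintegral_congr fun t => ?_))
      simp only [K]
      rw [Set.indicator_of_notMem fun h => hx h.1]
  rw [hleft, lintegral_lintegral_swap hK.aemeasurable,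
    lintegral_gammaMeasure θ (Measurable.lintegral_prod_right' hG)]
  refine lintegral_congr fun t => ?_
  by_cases ht : 0 < t
  · rw [Set.indicator_of_mem (by simpa using ht), lintegral_comp_mul_left ht (by fun_prop),
      lintegral_betaMeasure hθ (by fun_prop), ← lintegral_const_mul' _ _ (by simp),
      ← lintegral_const_mul' _ _ (by simp)]
    refine lintegral_congr fun v => ?_
    simp only [K]
    by_cases hv : v ∈ Set.Ioo (0 : ℝ) 1
    · have hv1 : 0 < 1 - v := sub_pos.2 hv.2
      have hmem : (t * v, t) ∈ {p : ℝ × ℝ | 0 < p.1 ∧ p.1 < p.2} :=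
        ⟨mul_pos ht hv.1, by nlinarith [hv.2]⟩
      rw [Set.indicator_of_mem hv, Set.indicator_of_mem hmem, ← mul_assoc, ← mul_assoc,
        ← ENNReal.ofReal_mul ht.le, ← ENNReal.ofReal_mul (by positivity)]
      simp only
      rw [show t * v / t = v by field_simp, show t - t * v = t * (1 - v) by ring,
        Real.mul_rpow ht.le hv1.le]
      congr 2
      field_simp
    · have hmem : (t * v, t) ∉ {p : ℝ × ℝ | 0 < p.1 ∧ p.1 < p.2} := fun h =>
        hv ⟨pos_of_mul_pos_right h.1 ht.le, by
          have h2 : t * v < t * 1 := by simpa using h.2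
          exact lt_of_mul_lt_mul_left h2 ht.le⟩
      rw [Set.indicator_of_notMem hv, Set.indicator_of_notMem hmem, mul_zero, mul_zero]
  · rw [Set.indicator_of_notMem (by simpa using ht)]
    refine (lintegral_congr fun x => ?_).trans lintegral_zero
    simp only [K]
    rw [Set.indicator_of_notMem fun h => ht (h.1.trans h.2)]

lemma measurable_finCons {k : ℕ} :
    Measurable fun p : ℝ × (Fin k → ℝ) => (Fin.cons p.1 p.2 : Fin (k + 1) → ℝ) := by
  refine measurable_pi_iff.2 fun j => ?_
  refine Fin.cases ?_ (fun j => ?_) j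
  · simpa using measurable_fst
  · simp only [Fin.cons_succ]
    fun_prop

lemma lintegral_pi_succ {k : ℕ} (μ : Measure ℝ) [SigmaFinite μ] {H : (Fin (k + 1) → ℝ) → ℝ≥0∞}
    (hH : Measurable H) :
    ∫⁻ x, H x ∂(Measure.pi fun _ => μ)
      = ∫⁻ x₀, ∫⁻ x, H (Fin.cons x₀ x) ∂(Measure.pi fun _ => μ) ∂μ := by
  have h := measurePreserving_piFinSuccAbove (fun _ : Fin (k + 1) => μ) 0
  rw [← h.symm.lintegral_comp hH, lintegral_prod _ (by
    exact (hH.comp (MeasurableEquiv.measurable _)).aemeasurable)]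
  simp [MeasurableEquiv.piFinSuccAbove, Fin.insertNthEquiv]

/-- The relative sizes `x_j / (s - ∑_{l < j} x_l)`. -/
def stickFrac {k : ℕ} (s : ℝ) (x : Fin k → ℝ) (j : Fin k) : ℝ :=
  x j / (s - ∑ l ∈ Finset.univ.filter (· < j), x l)

lemma stickFrac_cons_zero {k : ℕ} (s x₀ : ℝ) (x : Fin k → ℝ) :
    stickFrac s (Fin.cons x₀ x : Fin (k + 1) → ℝ) 0 = x₀ / s := by
  simp [stickFrac]

lemma sum_filter_lt_succ {k : ℕ} (x : Fin (k + 1) → ℝ) (j : Fin k) :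
    ∑ l ∈ Finset.univ.filter (· < j.succ), x l
      = x 0 + ∑ l ∈ Finset.univ.filter (· < j), x l.succ := by
  simp [Finset.sum_filter, Fin.sum_univ_succ]

lemma stickFrac_cons_succ {k : ℕ} (s x₀ : ℝ) (x : Fin k → ℝ) (j : Fin k) :
    stickFrac s (Fin.cons x₀ x : Fin (k + 1) → ℝ) j.succ = stickFrac (s - x₀) x j := by
  rw [stickFrac, stickFrac, sum_filter_lt_succ]
  simp [sub_sub]

lemma stickFrac_cons {k : ℕ} (s x₀ : ℝ) (x : Fin k → ℝ) :
    stickFrac s (Fin.cons x₀ x : Fin (k + 1) → ℝ)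
      = Fin.cons (x₀ / s) (stickFrac (s - x₀) x) := by
  funext j
  refine Fin.cases ?_ (fun j => ?_) j
  · simp [stickFrac_cons_zero]
  · simp [stickFrac_cons_succ]

@[fun_prop]
lemma measurable_stickFrac {k : ℕ} :
    Measurable fun p : ℝ × (Fin k → ℝ) => stickFrac p.1 p.2 := by
  unfold stickFrac
  fun_prop

/-- Induction on the number of points: by the hypothesis, all points but the first, together with
the remainder, have a Gamma(`θ`) total independent of their relative sizes. The two-variable
Beta-Gamma identity then adds the first point, because that total has the same law as the remainder
did. -/
lemma lintegral_stickFrac {θ : ℝ} (hθ : 0 < θ) (k : ℕ) {F : ℝ × (Fin k → ℝ) → ℝ≥0∞}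
    (hF : Measurable F) :
    ∫⁻ x, ∫⁻ w, (∏ j, ENNReal.ofReal (stickFrac (w + ∑ l, x l) x j)) *
        F (w + ∑ l, x l, stickFrac (w + ∑ l, x l) x) ∂(gammaMeasure θ 1)
        ∂(Measure.pi fun _ : Fin k => gammaIntensity θ)
      = ∫⁻ t, ∫⁻ v, F (t, v) ∂(Measure.pi fun _ => betaMeasure 1 θ) ∂(gammaMeasure θ 1) := by
  have : IsProbabilityMeasure (gammaMeasure θ 1) := isProbabilityMeasure_gammaMeasure hθ one_pos
  have : IsProbabilityMeasure (betaMeasure 1 θ) := isProbabilityMeasureBeta one_pos hθ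
  have hm {k : ℕ} {F : ℝ × (Fin k → ℝ) → ℝ≥0∞} (hF : Measurable F) :
      Measurable fun p : (Fin k → ℝ) × ℝ => (∏ j, ENNReal.ofReal (stickFrac (p.2 + ∑ l, p.1 l) p.1 j))
        * F (p.2 + ∑ l, p.1 l, stickFrac (p.2 + ∑ l, p.1 l) p.1) := by
    have h1 : Measurable fun p : (Fin k → ℝ) × ℝ => (p.2 + ∑ l, p.1 l, p.1) := by fun_prop
    have h2 := measurable_stickFrac.comp h1
    refine Measurable.mul ?_ ?_
    · exact Finset.measurable_prod _ fun j _ => ((measurable_pi_apply j).comp h2).ennreal_ofReal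
    · exact hF.comp ((measurable_fst.comp h1).prodMk h2)
  induction k with
  | zero =>
    have h (μ : Measure ℝ) (H : (Fin 0 → ℝ) → ℝ≥0∞) :
        ∫⁻ x, H x ∂(Measure.pi fun _ => μ) = H Fin.elim0 := by
      rw [Measure.pi_of_empty (fun _ : Fin 0 => μ) Fin.elim0, lintegral_dirac]
    simp_rw [h, Finset.univ_eq_empty, Finset.prod_empty, one_mul, Finset.sum_empty, add_zero]
    exact lintegral_congr fun t => by rw [Subsingleton.elim (stickFrac t Fin.elim0) Fin.elim0]
  | succ k ih =>
    have hcons := measurable_finCons (k := k)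
    rw [lintegral_pi_succ _ (Measurable.lintegral_prod_right' (hm hF))]
    have hx₀ (x₀ : ℝ) : ∫⁻ x, ∫⁻ w, (∏ j, ENNReal.ofReal (stickFrac
          (w + ∑ l, (Fin.cons x₀ x : Fin (k + 1) → ℝ) l) (Fin.cons x₀ x : Fin (k + 1) → ℝ) j)) *
          F (w + ∑ l, (Fin.cons x₀ x : Fin (k + 1) → ℝ) l,
            stickFrac (w + ∑ l, (Fin.cons x₀ x : Fin (k + 1) → ℝ) l) (Fin.cons x₀ x))
          ∂(gammaMeasure θ 1) ∂(Measure.pi fun _ : Fin k => gammaIntensity θ)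
        = ∫⁻ t, ∫⁻ v, ENNReal.ofReal (x₀ / (x₀ + t)) * F (x₀ + t, Fin.cons (x₀ / (x₀ + t)) v)
          ∂(Measure.pi fun _ => betaMeasure 1 θ) ∂(gammaMeasure θ 1) := by
      rw [← ih (F := fun p => ENNReal.ofReal (x₀ / (x₀ + p.1)) *
        F (x₀ + p.1, Fin.cons (x₀ / (x₀ + p.1)) p.2)) (by fun_prop)]
      refine lintegral_congr fun x => lintegral_congr fun w => ?_
      rw [Fin.sum_cons, Fin.prod_univ_succ, stickFrac_cons,
        show w + (x₀ + ∑ l, x l) = x₀ + (w + ∑ l, x l) by ring]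
      simp only [Fin.cons_zero, Fin.cons_succ, add_sub_cancel_left]
      ring
    simp_rw [hx₀]
    have hswap (x₀ : ℝ) : ∫⁻ t, ∫⁻ v, ENNReal.ofReal (x₀ / (x₀ + t)) *
        F (x₀ + t, Fin.cons (x₀ / (x₀ + t)) v) ∂(Measure.pi fun _ : Fin k => betaMeasure 1 θ)
          ∂(gammaMeasure θ 1)
        = ∫⁻ v, ∫⁻ t, ENNReal.ofReal (x₀ / (x₀ + t)) *
        F (x₀ + t, Fin.cons (x₀ / (x₀ + t)) v) ∂(gammaMeasure θ 1)
          ∂(Measure.pi fun _ : Fin k => betaMeasure 1 θ) :=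
      -- The later relative sizes `v` are moved outside, so that the Beta-Gamma identity applies to
      -- `x₀` and `t` with `v` frozen.
      lintegral_lintegral_swap (by unfold Function.uncurry; fun_prop)
    simp_rw [hswap]
    rw [lintegral_lintegral_swap]
    · have h2 (v : Fin k → ℝ) := lintegral_gammaIntensity_gammaMeasure hθ
        (G := fun p => F (p.1, Fin.cons p.2 v)) (by fun_prop)
      simp_rw [h2]
      rw [lintegral_lintegral_swap]
      · refine lintegral_congr fun t => ?_
        rw [lintegral_pi_succ _ (by fun_prop), lintegral_lintegral_swap]
        unfold Function.uncurry
        fun_prop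
      · refine Measurable.aemeasurable ?_
        exact Measurable.lintegral_prod_right' (f := fun p : ((Fin k → ℝ) × ℝ) × ℝ =>
          F (p.1.2, Fin.cons p.2 p.1.1)) (by fun_prop)
    · refine Measurable.aemeasurable ?_
      exact Measurable.lintegral_prod_right' (f := fun p : (ℝ × (Fin k → ℝ)) × ℝ =>
        ENNReal.ofReal (p.1.1 / (p.1.1 + p.2)) *
          F (p.1.1 + p.2, Fin.cons (p.1.1 / (p.1.1 + p.2)) p.1.2)) (by fun_prop)

/-! ### The law of the size-biased rearrangement -/

/-- The sum of the positive parts of the terms of a sequence (and `0` if it diverges). -/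
def seqSum (y : ℕ → ℝ) : ℝ := (∑' l, ENNReal.ofReal (y l)).toReal

@[fun_prop]
lemma measurable_seqSum : Measurable seqSum := by
  unfold seqSum
  fun_prop

lemma seqSum_eq_tsum {y : ℕ → ℝ} (hy : ∀ l, 0 ≤ y l) : seqSum y = ∑' l, y l := by
  rw [seqSum, ENNReal.tsum_toReal_eq fun l => ENNReal.ofReal_ne_top]
  exact tsum_congr fun l => ENNReal.toReal_ofReal (hy l)

lemma restSum_add_sum {k : ℕ} {i : Fin k → ℕ} (hi : Function.Injective i) (f : ℝ → ℝ≥0∞)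
    (y : ℕ → ℝ) : restSum i f y + ∑ j, f (y (i j)) = ∑' l, f (y l) := by
  induction k with
  | zero => simp [restSum_zero]
  | succ k ih =>
    have hi' := hi
    rw [← Fin.cons_self_tail i, Fin.cons_injective_iff] at hi'
    rw [← ih hi'.2, restSum_cons _ hi'.1, Fin.cons_self_tail, Fin.sum_univ_succ]
    simp only [Fin.tail]
    ring

lemma restSum_toReal_add_sum {k : ℕ} {i : Fin k → ℕ} (hi : Function.Injective i) {y : ℕ → ℝ}
    (hy : ∀ l, 0 ≤ y l) (hfin : ∑' l, ENNReal.ofReal (y l) ≠ ∞) :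
    (restSum i ENNReal.ofReal y).toReal + ∑ j, y (i j) = seqSum y := by
  rw [seqSum, ← restSum_add_sum hi, ENNReal.toReal_add
    (ne_top_of_le_ne_top hfin (restSum_ofReal_le i y)) (by simp), ENNReal.toReal_sum (by simp)]
  simp [ENNReal.toReal_ofReal (hy _)]

/-- Both sides integrate `G` against measures that agree on `m` by the definition of conditional
expectation. Comparing the trimmed measures avoids any integrability assumption on `G`. -/
lemma setLIntegral_eq_lintegral_condProb {Ω : Type*} {m mΩ : MeasurableSpace Ω} (hm : m ≤ mΩ)
    {P : Measure Ω} [IsProbabilityMeasure P] {A : Set Ω} (hA : MeasurableSet A)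
    {G : Ω → ℝ≥0∞} (hG : Measurable[m] G) :
    ∫⁻ ω in A, G ω ∂P = ∫⁻ ω, ENNReal.ofReal ((P⟦A|m⟧) ω) * G ω ∂P := by
  have hq : Measurable fun ω => ENNReal.ofReal ((P⟦A|m⟧) ω) :=
    (stronglyMeasurable_condExp.mono hm).measurable.ennreal_ofReal
  have h0 : 0 ≤ᵐ[P] P⟦A|m⟧ := condExp_nonneg (Eventually.of_forall fun ω =>
    Set.indicator_nonneg (fun _ _ => zero_le_one) ω)
  have key : (P.restrict A).trim hm = (P.withDensity fun ω => ENNReal.ofReal ((P⟦A|m⟧) ω)).trim hm := by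
    refine @Measure.ext _ m _ _ fun B hB => ?_
    have hint : Integrable (A.indicator fun _ => (1 : ℝ)) P :=
      (integrable_const 1).indicator hA
    rw [trim_measurableSet_eq hm hB, trim_measurableSet_eq hm hB, withDensity_apply _ (hm B hB),
      Measure.restrict_apply (hm B hB), ← ofReal_integral_eq_lintegral_ofReal
      integrable_condExp.integrableOn (ae_restrict_of_ae h0), setIntegral_condExp hm hint hB,
      setIntegral_indicator hA]
    simp
  calc ∫⁻ ω in A, G ω ∂P = ∫⁻ ω, G ω ∂((P.restrict A).trim hm) := (lintegral_trim hm hG).symm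
    _ = ∫⁻ ω, G ω ∂(P.withDensity fun ω => ENNReal.ofReal ((P⟦A|m⟧) ω)) := by
        rw [key, lintegral_trim hm hG]
    _ = _ := lintegral_withDensity_eq_lintegral_mul _ hq (hG.mono hm le_rfl)

section SizeBiased

variable {Ω : Type*} [MeasurableSpace Ω] {P : Measure Ω}
  {Y : ℕ → Ω → ℝ} {π : ℕ → Ω → ℕ} {θ : ℝ}

lemma measurable_arrangement (hY : ∀ l, Measurable (Y l)) (hπ : ∀ k, Measurable (π k)) :
    Measurable fun ω k => Y (π k ω) ω := by
  refine measurable_pi_iff.2 fun k => ?_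
  have h : Measurable fun p : ℕ × Ω => Y p.1 p.2 := measurable_from_prod_countable_right hY
  exact h.comp ((hπ k).prodMk measurable_id)

/-- The relative sizes of the first `k` terms of the size-biased rearrangement. -/
def arrangedFrac (Y : ℕ → Ω → ℝ) (π : ℕ → Ω → ℕ) (k : ℕ) (ω : Ω) : Fin k → ℝ :=
  stickFrac (seqSum fun l => Y l ω) fun j : Fin k => Y (π j ω) ω

lemma measurable_arrangedFrac (hY : ∀ l, Measurable (Y l)) (hπ : ∀ k, Measurable (π k)) (k : ℕ) :
    Measurable (arrangedFrac Y π k) := by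
  have h1 := measurable_arrangement hY hπ
  have h2 : Measurable fun ω => seqSum fun l => Y l ω :=
    measurable_seqSum.comp (measurable_pi_lambda _ hY)
  exact measurable_stickFrac.comp (h2.prodMk
    (measurable_pi_lambda _ fun j : Fin k => (measurable_pi_apply (j : ℕ)).comp h1))

lemma stickFrac_nonneg {k : ℕ} {s w : ℝ} {x : Fin k → ℝ} (hx : ∀ j, 0 ≤ x j) (hw : 0 ≤ w)
    (h : w + ∑ j, x j = s) (j : Fin k) : 0 ≤ stickFrac s x j := by
  refine div_nonneg (hx j) (sub_nonneg.2 ?_)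
  rw [← h]
  have := Finset.sum_le_sum_of_subset_of_nonneg (f := x)
    (Finset.filter_subset (· < j) Finset.univ) fun l _ _ => hx l
  linarith

lemma measurableSet_order (hπ : ∀ k, Measurable (π k)) {k : ℕ} (i : Fin k → ℕ) :
    MeasurableSet {ω | ∀ j : Fin k, π j ω = i j} := by
  simp_rw [Set.ofPred_forall]
  exact MeasurableSet.iInter fun j => hπ j (measurableSet_singleton _)

lemma lintegral_eq_tsum_order (hπ : ∀ k, Measurable (π k)) (k : ℕ) (H : Ω → ℝ≥0∞) :
    ∫⁻ ω, H ω ∂P = ∑' i : Fin k → ℕ, ∫⁻ ω in {ω | ∀ j : Fin k, π j ω = i j}, H ω ∂P := by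
  rw [← lintegral_iUnion (measurableSet_order hπ)]
  · rw [show (⋃ i : Fin k → ℕ, {ω | ∀ j : Fin k, π j ω = i j}) = Set.univ from
      Set.eq_univ_of_forall fun ω => Set.mem_iUnion.2 ⟨fun j => π j ω, fun j => rfl⟩,
      Measure.restrict_univ]
  · intro i i' hii'
    refine Set.disjoint_left.2 fun ω h h' => hii' (funext fun j => ?_)
    rw [← h j, ← h' j]

variable [IsProbabilityMeasure P]

/-- Conditioning on `Y` turns each event of drawing `i` into its size-biased probability, a product
of relative sizes. The sum over `i` is then a Mecke sum, to which the change of variables applies.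
-/
lemma sumDistinct_setLIntegral (hθ : 0 < θ) (hY : IsPoissonProcess P (gammaIntensity θ) Y)
    (hπ : IsSizeBiasedOrder P Y π) {k : ℕ} {F : ℝ × (Fin k → ℝ) → ℝ≥0∞} (hF : Measurable F) :
    sumDistinct (fun i : Fin k → ℕ => ∫⁻ ω in {ω | ∀ j : Fin k, π j ω = i j},
        F (seqSum fun l => Y l ω, arrangedFrac Y π k ω) ∂P)
      = ∫⁻ t, ∫⁻ v, F (t, v) ∂(Measure.pi fun _ => betaMeasure 1 θ) ∂(gammaMeasure θ 1) := by
  have hm : MeasurableSpace.comap (fun ω l => Y l ω) MeasurableSpace.pi ≤ ‹MeasurableSpace Ω› :=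
    (measurable_pi_lambda _ hY.measurable).comap_le
  have hF' : Measurable fun p : (Fin k → ℝ) × ℝ =>
      (∏ j, ENNReal.ofReal (stickFrac (p.2 + ∑ l, p.1 l) p.1 j)) *
        F (p.2 + ∑ l, p.1 l, stickFrac (p.2 + ∑ l, p.1 l) p.1) := by
    have h1 : Measurable fun p : (Fin k → ℝ) × ℝ => (p.2 + ∑ l, p.1 l, p.1) := by fun_prop
    have h2 := measurable_stickFrac.comp h1
    refine Measurable.mul ?_ ?_
    · exact Finset.measurable_prod _ fun j _ => ((measurable_pi_apply j).comp h2).ennreal_ofReal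
    · exact hF.comp ((measurable_fst.comp h1).prodMk h2)
  rw [← lintegral_stickFrac hθ k hF, ← hY.lintegral_sumDistinct hθ hF']
  unfold sumDistinct
  have hmeas (i : Fin k → ℕ) : Measurable fun ω => (fun j => Y (i j) ω,
      (restSum i ENNReal.ofReal fun l => Y l ω).toReal) :=
    (measurable_pi_lambda _ fun j => hY.measurable _).prodMk
    (measurable_restSum i ENNReal.measurable_ofReal hY.measurable).ennreal_toReal
  rw [MeasureTheory.lintegral_tsum]
  swap
  · intro i
    split_ifs
    · exact (hF'.comp (hmeas i)).aemeasurable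
    · exact aemeasurable_const
  refine tsum_congr fun i => ?_
  split_ifs with hi
  swap
  · simp
  have hA := measurableSet_order hπ.measurable i
  have hG : Measurable[MeasurableSpace.comap (fun ω l => Y l ω) MeasurableSpace.pi] fun ω => F (seqSum fun l => Y l ω,
      stickFrac (seqSum fun l => Y l ω) fun j => Y (i j) ω) := by
    have : Measurable fun y : ℕ → ℝ => F (seqSum y, stickFrac (seqSum y) fun j => y (i j)) := by
      refine hF.comp (measurable_seqSum.prodMk (measurable_stickFrac.comp
        (measurable_seqSum.prodMk ?_)))
      fun_prop
    exact this.comp (comap_measurable _)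
  have h1 : ∫⁻ ω in {ω | ∀ j : Fin k, π j ω = i j},
      F (seqSum fun l => Y l ω, arrangedFrac Y π k ω) ∂P
      = ∫⁻ ω in {ω | ∀ j : Fin k, π j ω = i j}, F (seqSum fun l => Y l ω,
      stickFrac (seqSum fun l => Y l ω) fun j => Y (i j) ω) ∂P := by
    refine setLIntegral_congr_fun hA fun ω hω => ?_
    have hω : ∀ j : Fin k, π j ω = i j := hω
    simp only [arrangedFrac, hω]
  refine h1.trans ?_
  rw [setLIntegral_eq_lintegral_condProb hm hA hG]
  refine lintegral_congr_ae ?_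
  filter_upwards [hπ.condProb k i hi, hY.ae_pos, hY.ae_tsum_ne_top hθ] with ω h2 hpos hfin
  have hnn (l) : 0 ≤ Y l ω := (hpos l).le
  have h3 := restSum_toReal_add_sum hi hnn hfin
  rw [h2, h3, ← seqSum_eq_tsum hnn, ← ENNReal.ofReal_prod_of_nonneg
    fun j _ => stickFrac_nonneg (fun j => hnn (i j)) ENNReal.toReal_nonneg h3 j]
  rfl

/-- The conditional probabilities are prescribed only for tuples without repetition. Those already
have total mass `1`, as the preceding identity with `F = 1` shows, so nothing is left for the
others. -/
lemma measure_order_eq_zero (hθ : 0 < θ) (hY : IsPoissonProcess P (gammaIntensity θ) Y)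
    (hπ : IsSizeBiasedOrder P Y π) {k : ℕ} {i : Fin k → ℕ} (hi : ¬ Function.Injective i) :
    P {ω | ∀ j : Fin k, π j ω = i j} = 0 := by
  classical
  have : IsProbabilityMeasure (gammaMeasure θ 1) := isProbabilityMeasure_gammaMeasure hθ one_pos
  have : IsProbabilityMeasure (betaMeasure 1 θ) := isProbabilityMeasureBeta one_pos hθ
  have h1 := sumDistinct_setLIntegral hθ hY hπ (k := k) (F := fun _ => 1) measurable_const
  have h2 := lintegral_eq_tsum_order (P := P) hπ.measurable k fun _ => 1
  simp only [lintegral_one, measure_univ, Measure.restrict_apply_univ] at h1 h2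
  unfold sumDistinct at h1
  have h3 : ∑' i : Fin k → ℕ, P {ω | ∀ j : Fin k, π j ω = i j}
      = (∑' i : Fin k → ℕ, if Function.Injective i then P {ω | ∀ j : Fin k, π j ω = i j} else 0)
      + ∑' i : Fin k → ℕ, if Function.Injective i then 0 else P {ω | ∀ j : Fin k, π j ω = i j} := by
    rw [← ENNReal.tsum_add]
    refine tsum_congr fun i => ?_
    split_ifs <;> simp
  rw [← h2, h1] at h3
  have h4 := (ENNReal.add_right_inj ENNReal.one_ne_top).1 ((add_zero _).trans h3)
  have h5 := ENNReal.tsum_eq_zero.1 h4.symm i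
  rwa [if_neg hi] at h5

/-- The sum of the points and the relative sizes of the points in size-biased order are
independent, with a Gamma and with Beta distributions. -/
theorem map_arrangedFrac (hθ : 0 < θ) (hY : IsPoissonProcess P (gammaIntensity θ) Y)
    (hπ : IsSizeBiasedOrder P Y π) (k : ℕ) :
    P.map (fun ω => (seqSum fun l => Y l ω, arrangedFrac Y π k ω))
      = (gammaMeasure θ 1).prod (Measure.pi fun _ => betaMeasure 1 θ) := by
  have : IsProbabilityMeasure (gammaMeasure θ 1) := isProbabilityMeasure_gammaMeasure hθ one_pos
  have : IsProbabilityMeasure (betaMeasure 1 θ) := isProbabilityMeasureBeta one_pos hθ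
  refine Measure.ext_of_lintegral _ fun F hF => ?_
  have hS : Measurable fun ω => seqSum fun l => Y l ω :=
    measurable_seqSum.comp (measurable_pi_lambda _ hY.measurable)
  rw [lintegral_map hF (hS.prodMk (measurable_arrangedFrac hY.measurable hπ.measurable k)),
    lintegral_prod _ hF.aemeasurable,
    ← sumDistinct_setLIntegral hθ hY hπ hF, lintegral_eq_tsum_order hπ.measurable k]
  unfold sumDistinct
  refine tsum_congr fun i => ?_
  split_ifs with hi
  · rfl
  · exact setLIntegral_measure_zero _ _ (measure_order_eq_zero hθ hY hπ hi)

lemma ae_injective (hθ : 0 < θ) (hY : IsPoissonProcess P (gammaIntensity θ) Y)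
    (hπ : IsSizeBiasedOrder P Y π) : ∀ᵐ ω ∂P, Function.Injective fun k => π k ω := by
  have h : ∀ᵐ ω ∂P, ∀ (k : ℕ) (i : Fin k → ℕ), ¬ Function.Injective i →
      ¬ ∀ j : Fin k, π j ω = i j := by
    simp_rw [ae_all_iff]
    intro k i hi
    rw [ae_iff]
    simpa using measure_order_eq_zero hθ hY hπ hi
  filter_upwards [h] with ω hω a b hab
  have h1 : Function.Injective fun j : Fin (max a b + 1) => π j ω := by
    by_contra hi
    exact hω _ _ hi fun j => rfl
  have h2 := @h1 ⟨a, by omega⟩ ⟨b, by omega⟩ hab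
  simpa using h2

end SizeBiased

/-! ### Rising factorials and explicit forms of the polynomials -/

@[simp] lemma rising_zero (a : ℝ) : rising a 0 = 1 := by simp [rising]

lemma rising_succ (a : ℝ) (k : ℕ) : rising a (k + 1) = rising a k * (a + k) :=
  ascPochhammer_succ_eval k a

lemma rising_pos {a : ℝ} (ha : 0 < a) (k : ℕ) : 0 < rising a k := ascPochhammer_pos k a ha

lemma rising_eq_prod (a : ℝ) (k : ℕ) : rising a k = ∏ i ∈ Finset.range k, (a + i) := by
  induction k with
  | zero => simp
  | succ k ih => rw [rising_succ, ih, Finset.prod_range_succ]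

lemma rising_add (a : ℝ) (n m : ℕ) : rising a (n + m) = rising a n * rising (a + n) m := by
  simp_rw [rising_eq_prod, Finset.prod_range_add]
  push_cast
  simp_rw [add_assoc]

lemma rising_neg_div_factorial (m k : ℕ) :
    rising (-(m : ℝ)) k / k.factorial = (-1) ^ k * m.choose k := by
  rw [rising, ascPochhammer_eval_neg_eq_descPochhammer, descPochhammer_eval_eq_descFactorial,
    Nat.descFactorial_eq_factorial_mul_choose]
  have := k.factorial_ne_zero
  push_cast
  field_simp

/-- Up to sign, the sum is the `n`-th forward difference of `p` at `0`. -/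
lemma sum_choose_mul_eval_eq_zero {p : ℝ[X]} {n : ℕ} (hp : p.natDegree < n) :
    ∑ k ∈ Finset.range (n + 1), (-1) ^ k * (n.choose k : ℝ) * p.eval (k : ℝ) = 0 := by
  have h := congrFun (Polynomial.fwdDiff_iter_eq_zero_of_degree_lt hp) 0
  rw [fwdDiff_iter_eq_sum_shift] at h
  have h2 : ∑ k ∈ Finset.range (n + 1), (-1) ^ k * (n.choose k : ℝ) * p.eval (k : ℝ)
      = (-1) ^ n * ∑ k ∈ Finset.range (n + 1),
        ((-1 : ℤ) ^ (n - k) * n.choose k) • p.eval (0 + k • 1 : ℝ) := by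
    rw [Finset.mul_sum]
    refine Finset.sum_congr rfl fun k hk => ?_
    obtain ⟨d, rfl⟩ := Nat.exists_eq_add_of_le (Nat.lt_succ_iff.1 (Finset.mem_range.1 hk))
    have hs : ((-1 : ℝ) ^ d) * (-1) ^ d = 1 := by rw [← mul_pow]; simp
    simp only [zsmul_eq_mul, nsmul_eq_mul, mul_one, zero_add, Nat.add_sub_cancel_left]
    push_cast
    rw [pow_add]
    linear_combination (-(-1) ^ k * ((k + d).choose k : ℝ) * eval (k : ℝ) p) * hs
  rw [h2, h]
  simp

/-- The coefficients of the shifted Jacobi polynomial `R_n^{(1, b)}` in powers of `1 - x`. -/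
def jacobiCoeff (b : ℝ) (n k : ℕ) : ℝ :=
  rising (-(n : ℝ)) k * rising (n + b) k / (rising b k * k.factorial)

lemma eval_shiftedJacobi {b : ℝ} (hb : 0 < b) (n : ℕ) (x : ℝ) :
    (shiftedJacobi 1 b n).eval x
      = ∑ k ∈ Finset.range (n + 1), jacobiCoeff b n k * (1 - x) ^ k := by
  have hJ (y : ℝ) : (jacobi (b - 1) (1 - 1) n).eval y = rising b n / n.factorial *
      ∑ k ∈ Finset.range (n + 1), jacobiCoeff b n k * ((1 - y) / 2) ^ k := by
    rw [jacobi, eval_mul, eval_C, eval_finsetSum]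
    simp only [sub_self, add_zero, sub_add_cancel, eval_mul, eval_C, eval_pow, eval_sub, eval_one,
      eval_X, jacobiCoeff]
    congr 1
    refine Finset.sum_congr rfl fun k _ => ?_
    rw [show (n : ℝ) + (b - 1) + 1 = n + b by ring]
    ring
  have h1 : (jacobi (b - 1) (1 - 1) n).eval 1 = rising b n / n.factorial := by
    rw [hJ, Finset.sum_eq_single 0]
    · simp [jacobiCoeff]
    · intro k _ hk
      simp [hk]
    · simp
  have h0 : rising b n / n.factorial ≠ 0 :=
    (div_pos (rising_pos hb n) (by exact_mod_cast n.factorial_pos)).ne'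
  rw [shiftedJacobi, eval_mul, eval_C, h1, eval_comp, hJ, inv_mul_cancel_left₀ h0]
  refine Finset.sum_congr rfl fun k _ => ?_
  congr 2
  simp
  ring

lemma eval_one_shiftedJacobi {b : ℝ} (hb : 0 < b) (n : ℕ) : (shiftedJacobi 1 b n).eval 1 = 1 := by
  rw [eval_shiftedJacobi hb, Finset.sum_eq_single 0]
  · simp [jacobiCoeff]
  · intro k _ hk
    simp [hk]
  · simp

lemma shiftedJacobi_zero {b : ℝ} (hb : 0 < b) (x : ℝ) : (shiftedJacobi 1 b 0).eval x = 1 := by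
  rw [eval_shiftedJacobi hb]
  simp [jacobiCoeff]

/-- The coefficient is `(-1) ^ k (n choose k) (n + b)_k / (b)_k`, and the last quotient equals `(b +
k)_n / (b)_n`. This has degree `n` in `k` and contains the factor `b + k + j`; dividing by it leaves
a polynomial of degree `n - 1`, killed by the `n`-th difference. -/
lemma sum_jacobiCoeff_div_eq_zero {b : ℝ} (hb : 0 < b) {n j : ℕ} (hj : j < n) :
    ∑ k ∈ Finset.range (n + 1), jacobiCoeff b n k / (b + k + j) = 0 := by
  let p : ℝ[X] := ∏ i ∈ (Finset.range n).erase j, (X + C (b + i))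
  have hp : p.natDegree < n := by
    refine (natDegree_prod_le _ _).trans_lt ?_
    simp_rw [natDegree_X_add_C]
    rw [Finset.sum_const, Finset.card_erase_of_mem (Finset.mem_range.2 hj), Finset.card_range]
    simp
    omega
  rw [← mul_zero (rising b n)⁻¹, ← sum_choose_mul_eval_eq_zero hp, Finset.mul_sum]
  refine Finset.sum_congr rfl fun k _ => ?_
  have hpos : 0 < b + k + j := by positivity
  have h1 : p.eval (k : ℝ) * (b + k + j) = rising (b + k) n := by
    rw [rising_eq_prod, ← Finset.prod_erase_mul _ _ (Finset.mem_range.2 hj), eval_prod]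
    congr 1
    refine Finset.prod_congr rfl fun i _ => ?_
    simp
    ring
  have h2 : rising b k * rising (b + k) n = rising b n * rising (n + b) k := by
    rw [← rising_add, add_comm k n, rising_add, add_comm b n]
  have hbk := rising_pos hb k
  have hbn := rising_pos hb n
  have hk : (k.factorial : ℝ) ≠ 0 := by exact_mod_cast k.factorial_ne_zero
  rw [← rising_neg_div_factorial, jacobiCoeff]
  field_simp
  linear_combination (-rising (-(n : ℝ)) k) * h2 + (-rising (-(n : ℝ)) k * rising b k) * h1

/-- The coefficients of the Laguerre polynomials. -/
def laguerreCoeff (a : ℝ) (m k : ℕ) : ℝ :=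
  rising a m / m.factorial * (rising (-(m : ℝ)) k / (rising a k * k.factorial))

lemma laguerre_eq_sum (a : ℝ) (m : ℕ) :
    laguerre a m = ∑ k ∈ Finset.range (m + 1), C (laguerreCoeff a m k) * X ^ k := by
  simp_rw [laguerre, Finset.mul_sum, laguerreCoeff, C_mul, mul_assoc]

lemma eval_laguerre (a : ℝ) (m : ℕ) (x : ℝ) :
    (laguerre a m).eval x = ∑ k ∈ Finset.range (m + 1), laguerreCoeff a m k * x ^ k := by
  simp [laguerre_eq_sum, eval_finsetSum]

lemma natDegree_laguerre {a : ℝ} (ha : 0 < a) (m : ℕ) : (laguerre a m).natDegree = m := by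
  refine natDegree_eq_of_le_of_coeff_ne_zero ?_ ?_
  · rw [laguerre_eq_sum]
    refine natDegree_sum_le_of_forall_le _ _ fun k hk => ?_
    exact (natDegree_C_mul_X_pow_le _ _).trans (Nat.lt_succ_iff.1 (Finset.mem_range.1 hk))
  · rw [laguerre_eq_sum, finsetSum_coeff]
    simp only [coeff_C_mul, coeff_X_pow, mul_ite, mul_one, mul_zero, Finset.sum_ite_eq,
      Finset.mem_range, Nat.lt_succ_self, if_true, laguerreCoeff]
    have h1 := rising_pos ha m
    have h2 : (m.factorial : ℝ) ≠ 0 := by exact_mod_cast m.factorial_ne_zero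
    have h3 := rising_neg_div_factorial m m
    rw [Nat.choose_self, Nat.cast_one, mul_one, div_eq_iff h2] at h3
    rw [h3]
    positivity

lemma laguerre_ne_zero {a : ℝ} (ha : 0 < a) (m : ℕ) : laguerre a m ≠ 0 := by
  intro h
  have h0 : (laguerre a m).eval 0 = 0 := by simp [h]
  rw [eval_laguerre, Finset.sum_eq_single 0 (fun k _ hk => by simp [hk]) (by simp)] at h0
  have h1 := rising_pos ha m
  have h2 : (0 : ℝ) < m.factorial := by exact_mod_cast m.factorial_pos
  have h3 : 0 < laguerreCoeff a m 0 := by simp only [laguerreCoeff, rising_zero]; positivity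
  simp at h0
  exact h3.ne' h0

/-- Since `(a)_{k+j} / (a)_k = (a + k)_j` has degree `j < m` in `k`, the alternating binomial sum
vanishes. -/
lemma sum_laguerreCoeff_mul_rising_eq_zero {a : ℝ} (ha : 0 < a) {m j : ℕ} (hj : j < m) :
    ∑ k ∈ Finset.range (m + 1), laguerreCoeff a m k * rising a (k + j) = 0 := by
  let p : ℝ[X] := (ascPochhammer ℝ j).comp (X + C a)
  have hp : p.natDegree < m := by
    rw [natDegree_comp, ascPochhammer_natDegree, natDegree_X_add_C, mul_one]
    exact hj
  rw [← mul_zero (rising a m / m.factorial), ← sum_choose_mul_eval_eq_zero hp, Finset.mul_sum]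
  refine Finset.sum_congr rfl fun k _ => ?_
  have h1 : p.eval (k : ℝ) = rising (a + k) j := by simp [p, rising, add_comm]
  have h2 := rising_pos ha k
  have hk : (k.factorial : ℝ) ≠ 0 := by exact_mod_cast k.factorial_ne_zero
  rw [h1, rising_add, ← rising_neg_div_factorial, laguerreCoeff]
  field_simp

/-! ### Moments and orthogonality -/

/-- The weight `x ^ s` turns the Gamma(`θ`) density into a multiple of the Gamma(`θ + s`) density,
whose total mass is `1`. -/
lemma lintegral_pow_gammaMeasure {θ : ℝ} (hθ : 0 < θ) (s : ℕ) :
    ∫⁻ x, ENNReal.ofReal (x ^ s) ∂(gammaMeasure θ 1) = ENNReal.ofReal (rising θ s) := by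
  have hs : 0 < θ + s := by positivity
  have : IsProbabilityMeasure (gammaMeasure (θ + s) 1) :=
    isProbabilityMeasure_gammaMeasure hs one_pos
  have hG : Real.Gamma (θ + s) = rising θ s * Real.Gamma θ := by
    induction s with
    | zero => simp
    | succ s ih =>
      have hs' : 0 < θ + s := by positivity
      push_cast
      rw [← add_assoc, Real.Gamma_add_one hs'.ne', ih hs'
        (isProbabilityMeasure_gammaMeasure hs' one_pos), rising_succ]
      ring
  have h1 := lintegral_gammaMeasure (θ + s) (f := fun _ => 1) measurable_const
  rw [lintegral_one, measure_univ] at h1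
  rw [lintegral_gammaMeasure θ (by fun_prop), ← mul_one (ENNReal.ofReal (rising θ s)), h1,
    ← lintegral_const_mul' _ _ (by simp)]
  refine lintegral_congr fun x => ?_
  by_cases hx : x ∈ Set.Ioi (0 : ℝ)
  · have hx0 : 0 < x := hx
    have h2 := Real.Gamma_pos_of_pos hθ
    have h3 := rising_pos hθ s
    rw [Set.indicator_of_mem hx, Set.indicator_of_mem hx, mul_one,
      ← ENNReal.ofReal_mul (by positivity), ← ENNReal.ofReal_mul h3.le, hG,
      show θ + s - 1 = (θ - 1) + s by ring, Real.rpow_add hx0, Real.rpow_natCast]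
    congr 1
    field_simp
  · rw [Set.indicator_of_notMem hx, Set.indicator_of_notMem hx, mul_zero]

lemma integrable_pow_gammaMeasure {θ : ℝ} (hθ : 0 < θ) (s : ℕ) :
    Integrable (fun x => x ^ s) (gammaMeasure θ 1) := by
  refine ⟨by fun_prop, ?_⟩
  rw [hasFiniteIntegral_iff_ofReal]
  · rw [lintegral_pow_gammaMeasure hθ]
    exact ENNReal.ofReal_lt_top
  · filter_upwards [ae_pos_gammaMeasure θ] with x hx
    exact pow_nonneg hx.le s

lemma integral_pow_gammaMeasure {θ : ℝ} (hθ : 0 < θ) (s : ℕ) :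
    ∫ x, x ^ s ∂(gammaMeasure θ 1) = rising θ s := by
  rw [integral_eq_lintegral_of_nonneg_ae, lintegral_pow_gammaMeasure hθ,
    ENNReal.toReal_ofReal (rising_pos hθ s).le]
  · filter_upwards [ae_pos_gammaMeasure θ] with x hx
    exact pow_nonneg hx.le s
  · fun_prop

lemma ae_mem_Ioo_betaMeasure {θ : ℝ} (hθ : 0 < θ) :
    ∀ᵐ v ∂(betaMeasure 1 θ), v ∈ Set.Ioo (0 : ℝ) 1 := by
  rw [ae_iff]
  change betaMeasure 1 θ (Set.Ioo (0 : ℝ) 1)ᶜ = 0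
  rw [← lintegral_indicator_one measurableSet_Ioo.compl,
    lintegral_betaMeasure hθ (measurable_one.indicator measurableSet_Ioo.compl)]
  refine (lintegral_congr fun x => ?_).trans lintegral_zero
  by_cases hx : x ∈ Set.Ioo (0 : ℝ) 1
  · rw [Set.indicator_of_mem hx, Set.indicator_of_notMem (by simpa using hx), mul_zero]
  · rw [Set.indicator_of_notMem hx]

lemma lintegral_pow_betaMeasure {θ : ℝ} (hθ : 0 < θ) (s : ℕ) :
    ∫⁻ v, ENNReal.ofReal ((1 - v) ^ s) ∂(betaMeasure 1 θ) = ENNReal.ofReal (θ / (θ + s)) := by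
  have hs : 0 < θ + s := by positivity
  have : IsProbabilityMeasure (betaMeasure 1 (θ + s)) := isProbabilityMeasureBeta one_pos hs
  have h1 := lintegral_betaMeasure hs (f := fun _ => 1) measurable_const
  rw [lintegral_one, measure_univ] at h1
  rw [lintegral_betaMeasure hθ (by fun_prop), ← mul_one (ENNReal.ofReal (θ / (θ + s))), h1,
    ← lintegral_const_mul' _ _ (by simp)]
  refine lintegral_congr fun x => ?_
  by_cases hx : x ∈ Set.Ioo (0 : ℝ) 1
  · have hx0 : 0 < 1 - x := sub_pos.2 hx.2
    rw [Set.indicator_of_mem hx, Set.indicator_of_mem hx, mul_one,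
      ← ENNReal.ofReal_mul (by positivity), ← ENNReal.ofReal_mul (by positivity),
      show θ + s - 1 = (θ - 1) + s by ring, Real.rpow_add hx0, Real.rpow_natCast]
    congr 1
    field_simp
  · rw [Set.indicator_of_notMem hx, Set.indicator_of_notMem hx, mul_zero]

lemma ae_one_sub_pow_nonneg {θ : ℝ} (hθ : 0 < θ) (s : ℕ) :
    ∀ᵐ v ∂(betaMeasure 1 θ), 0 ≤ (1 - v) ^ s := by
  filter_upwards [ae_mem_Ioo_betaMeasure hθ] with v hv
  exact pow_nonneg (sub_nonneg.2 hv.2.le) s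

lemma integrable_pow_betaMeasure {θ : ℝ} (hθ : 0 < θ) (s : ℕ) :
    Integrable (fun v => (1 - v) ^ s) (betaMeasure 1 θ) := by
  refine ⟨by fun_prop, ?_⟩
  rw [hasFiniteIntegral_iff_ofReal (ae_one_sub_pow_nonneg hθ s), lintegral_pow_betaMeasure hθ]
  exact ENNReal.ofReal_lt_top

lemma integral_pow_betaMeasure {θ : ℝ} (hθ : 0 < θ) (s : ℕ) :
    ∫ v, (1 - v) ^ s ∂(betaMeasure 1 θ) = θ / (θ + s) := by
  rw [integral_eq_lintegral_of_nonneg_ae (ae_one_sub_pow_nonneg hθ s) (by fun_prop),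
    lintegral_pow_betaMeasure hθ, ENNReal.toReal_ofReal (by positivity)]

lemma integrable_eval_gammaMeasure {θ : ℝ} (hθ : 0 < θ) (p : ℝ[X]) :
    Integrable (fun x => p.eval x) (gammaMeasure θ 1) := by
  simp_rw [eval_eq_sum_range]
  exact integrable_finsetSum _ fun s _ => (integrable_pow_gammaMeasure hθ s).const_mul _

lemma integrable_eval_betaMeasure {θ : ℝ} (hθ : 0 < θ) (p : ℝ[X]) :
    Integrable (fun v => p.eval v) (betaMeasure 1 θ) := by
  have h (v : ℝ) : p.eval v = (p.comp (1 - X)).eval (1 - v) := by simp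
  simp_rw [h, eval_eq_sum_range (p := p.comp (1 - X))]
  exact integrable_finsetSum _ fun s _ => (integrable_pow_betaMeasure hθ s).const_mul _

/-- In powers of `1 - v` the moments of Beta(`1, θ`) are `θ / (θ + s)`, which turns the integral
into the sum of `sum_jacobiCoeff_div_eq_zero` with `b = θ + 2 N`. -/
lemma integral_shiftedJacobi_mul_pow {θ : ℝ} (hθ : 0 < θ) (N : ℕ) {n j : ℕ} (hj : j < n) :
    ∫ v, (shiftedJacobi 1 (θ + 2 * N) n).eval v * (1 - v) ^ (j + 2 * N) ∂(betaMeasure 1 θ) = 0 := by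
  have hb : 0 < θ + 2 * N := by positivity
  simp_rw [eval_shiftedJacobi hb, Finset.sum_mul, mul_assoc, ← pow_add]
  rw [integral_finsetSum _ fun k _ => (integrable_pow_betaMeasure hθ _).const_mul _]
  simp_rw [integral_const_mul, integral_pow_betaMeasure hθ]
  rw [← mul_zero θ, ← sum_jacobiCoeff_div_eq_zero hb hj, Finset.mul_sum]
  refine Finset.sum_congr rfl fun k _ => ?_
  push_cast
  rw [show θ + ((k : ℝ) + (j + 2 * N)) = θ + 2 * N + k + j by ring]
  ring

lemma integral_shiftedJacobi_mul_of_lt {θ : ℝ} (hθ : 0 < θ) (N : ℕ) {n n' : ℕ} (h : n' < n) :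
    ∫ v, (shiftedJacobi 1 (θ + 2 * N) n).eval v * (shiftedJacobi 1 (θ + 2 * N) n').eval v
      * (1 - v) ^ (2 * N) ∂(betaMeasure 1 θ) = 0 := by
  have hb : 0 < θ + 2 * N := by positivity
  have h1 (v : ℝ) : (shiftedJacobi 1 (θ + 2 * N) n).eval v * (shiftedJacobi 1 (θ + 2 * N) n').eval v
      * (1 - v) ^ (2 * N) = ∑ j ∈ Finset.range (n' + 1), jacobiCoeff (θ + 2 * N) n' j *
        ((shiftedJacobi 1 (θ + 2 * N) n).eval v * (1 - v) ^ (j + 2 * N)) := by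
    rw [eval_shiftedJacobi hb n', Finset.mul_sum, Finset.sum_mul]
    refine Finset.sum_congr rfl fun j _ => ?_
    rw [pow_add]
    ring
  have h2 (j : ℕ) : Integrable (fun v => (shiftedJacobi 1 (θ + 2 * N) n).eval v *
      (1 - v) ^ (j + 2 * N)) (betaMeasure 1 θ) := by
    have := integrable_eval_betaMeasure hθ
      (shiftedJacobi 1 (θ + 2 * N) n * (1 - X) ^ (j + 2 * N))
    simpa only [eval_mul, eval_pow, eval_sub, eval_one, eval_X] using this
  simp_rw [h1]
  rw [integral_finsetSum _ fun j _ => (h2 j).const_mul _]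
  refine Finset.sum_eq_zero fun j hj => ?_
  rw [integral_const_mul, integral_shiftedJacobi_mul_pow hθ N
    (by have := Finset.mem_range.1 hj; omega), mul_zero]

lemma integral_shiftedJacobi_mul {θ : ℝ} (hθ : 0 < θ) (N : ℕ) {n n' : ℕ} (h : n ≠ n') :
    ∫ v, (shiftedJacobi 1 (θ + 2 * N) n).eval v * (shiftedJacobi 1 (θ + 2 * N) n').eval v
      * (1 - v) ^ (2 * N) ∂(betaMeasure 1 θ) = 0 := by
  rcases h.lt_or_gt with h | h
  · simp_rw [mul_comm (eval _ (shiftedJacobi 1 (θ + 2 * N) n))]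
    exact integral_shiftedJacobi_mul_of_lt hθ N h
  · exact integral_shiftedJacobi_mul_of_lt hθ N h

lemma integral_laguerre_mul_pow {θ : ℝ} (hθ : 0 < θ) (d : ℕ) {m j : ℕ} (hj : j < m) :
    ∫ x, (laguerre (θ + 2 * d) m).eval x * x ^ (j + 2 * d) ∂(gammaMeasure θ 1) = 0 := by
  have ha : 0 < θ + 2 * d := by positivity
  simp_rw [eval_laguerre, Finset.sum_mul, mul_assoc, ← pow_add]
  rw [integral_finsetSum _ fun k _ => (integrable_pow_gammaMeasure hθ _).const_mul _]
  simp_rw [integral_const_mul, integral_pow_gammaMeasure hθ]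
  rw [← mul_zero (rising θ (2 * d)), ← sum_laguerreCoeff_mul_rising_eq_zero ha hj, Finset.mul_sum]
  refine Finset.sum_congr rfl fun k _ => ?_
  rw [show k + (j + 2 * d) = 2 * d + (k + j) by ring, rising_add]
  push_cast
  ring

lemma integral_laguerre_mul_of_lt {θ : ℝ} (hθ : 0 < θ) (d : ℕ) {m m' : ℕ} (h : m' < m) :
    ∫ x, (laguerre (θ + 2 * d) m).eval x * (laguerre (θ + 2 * d) m').eval x
      * x ^ (2 * d) ∂(gammaMeasure θ 1) = 0 := by
  have h1 (x : ℝ) : (laguerre (θ + 2 * d) m).eval x * (laguerre (θ + 2 * d) m').eval x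
      * x ^ (2 * d) = ∑ j ∈ Finset.range (m' + 1), laguerreCoeff (θ + 2 * d) m' j *
        ((laguerre (θ + 2 * d) m).eval x * x ^ (j + 2 * d)) := by
    rw [eval_laguerre _ m', Finset.mul_sum, Finset.sum_mul]
    refine Finset.sum_congr rfl fun j _ => ?_
    rw [pow_add]
    ring
  have h2 (j : ℕ) : Integrable (fun x => (laguerre (θ + 2 * d) m).eval x *
      x ^ (j + 2 * d)) (gammaMeasure θ 1) := by
    have := integrable_eval_gammaMeasure hθ (laguerre (θ + 2 * d) m * X ^ (j + 2 * d))
    simpa only [eval_mul, eval_pow, eval_X] using this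
  simp_rw [h1]
  rw [integral_finsetSum _ fun j _ => (h2 j).const_mul _]
  refine Finset.sum_eq_zero fun j hj => ?_
  rw [integral_const_mul, integral_laguerre_mul_pow hθ d
    (by have := Finset.mem_range.1 hj; omega), mul_zero]

lemma integral_laguerre_mul {θ : ℝ} (hθ : 0 < θ) (d : ℕ) {m m' : ℕ} (h : m ≠ m') :
    ∫ x, (laguerre (θ + 2 * d) m).eval x * (laguerre (θ + 2 * d) m').eval x
      * x ^ (2 * d) ∂(gammaMeasure θ 1) = 0 := by
  rcases h.lt_or_gt with h | h
  · simp_rw [mul_comm (eval _ (laguerre (θ + 2 * d) m))]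
    exact integral_laguerre_mul_of_lt hθ d h
  · exact integral_laguerre_mul_of_lt hθ d h

lemma integral_eval_sq_pos {μ : Measure ℝ} [NullSingletonClass μ] [NeZero μ] {p : ℝ[X]} (hp : p ≠ 0)
    (hint : Integrable (fun x => p.eval x ^ 2) μ) : 0 < ∫ x, p.eval x ^ 2 ∂μ := by
  rw [integral_pos_iff_support_of_nonneg (fun x => sq_nonneg _) hint, pos_iff_ne_zero]
  intro h
  have h0 : μ {x | p.IsRoot x} = 0 := (p.rootSet_finite ℝ |>.subset fun x hx => by
    rw [mem_rootSet]; exact ⟨hp, by simpa using hx⟩).measure_zero μ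
  have huniv : (Set.univ : Set ℝ) ⊆ (Function.support fun x => p.eval x ^ 2) ∪ {x | p.IsRoot x} := by
    intro x _
    by_cases hx : p.eval x = 0
    · exact Or.inr hx
    · exact Or.inl (by simpa using hx)
  have := measure_mono_null huniv (measure_union_null h h0)
  exact NeZero.ne μ (Measure.measure_univ_eq_zero.1 this)

instance nullSingletonClass_gammaMeasure (a r : ℝ) : NullSingletonClass (gammaMeasure a r) := by
  unfold gammaMeasure
  infer_instance

instance nullSingletonClass_betaMeasure (a b : ℝ) : NullSingletonClass (betaMeasure a b) := by
  unfold betaMeasure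
  infer_instance

/-! ### Stick breaking -/

/-- The relative sizes `x_j / (s - ∑_{i < j} x_i)` of the terms of a sequence. -/
def stick (s : ℝ) (x : ℕ → ℝ) (j : ℕ) : ℝ := x j / (s - ∑ i ∈ Finset.range j, x i)

lemma stickFrac_eq_stick {k : ℕ} (s : ℝ) (x : ℕ → ℝ) (j : Fin k) :
    stickFrac s (fun j : Fin k => x j) j = stick s x j := by
  unfold stickFrac stick
  congr 2
  change ∑ l ∈ Finset.univ.filter (· < j), x (Fin.valEmbedding l) = _
  rw [← Finset.sum_map (Finset.univ.filter (· < j)) Fin.valEmbedding x]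
  congr 1
  ext l
  simp only [Finset.mem_map, Finset.mem_filter, Finset.mem_univ, true_and,
    Fin.valEmbedding_apply, Finset.mem_range]
  constructor
  · rintro ⟨a, ha, rfl⟩
    exact ha
  · intro h
    exact ⟨⟨l, h.trans j.2⟩, h, rfl⟩

lemma prod_one_sub_stick {s : ℝ} {x : ℕ → ℝ} (h : ∀ k, 0 < s - ∑ i ∈ Finset.range k, x i) (k : ℕ) :
    ∏ i ∈ Finset.range k, (1 - stick s x i) = (s - ∑ i ∈ Finset.range k, x i) / s := by
  have hs : 0 < s := by simpa using h 0
  induction k with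
  | zero => simp [hs.ne']
  | succ k ih =>
    have hk := (h k).ne'
    rw [Finset.prod_range_succ, ih, stick, Finset.sum_range_succ]
    field_simp
    ring

lemma arrangedFrac_eq_stick {Ω : Type*} (Y : ℕ → Ω → ℝ) (π : ℕ → Ω → ℕ) (k : ℕ) (ω : Ω) (j : Fin k) :
    arrangedFrac Y π k ω j = stick (seqSum fun l => Y l ω) (fun l => Y (π l ω) ω) j :=
  stickFrac_eq_stick _ (fun l => Y (π l ω) ω) j

section SizeBiased

variable {Ω : Type*} [MeasurableSpace Ω] {P : Measure Ω} [IsProbabilityMeasure P]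
  {Y : ℕ → Ω → ℝ} {π : ℕ → Ω → ℕ} {θ : ℝ}

lemma ae_remainder_pos (hθ : 0 < θ) (hY : IsPoissonProcess P (gammaIntensity θ) Y)
    (hπ : IsSizeBiasedOrder P Y π) :
    ∀ᵐ ω ∂P, ∀ k, 0 < (seqSum fun l => Y l ω) - ∑ i ∈ Finset.range k, Y (π i ω) ω := by
  filter_upwards [hY.ae_pos, hY.ae_tsum_ne_top hθ, ae_injective hθ hY hπ] with ω hpos hfin hinj k
  -- One term more than the remainder in question: the next term is itself positive and still fits
  -- into the total, which makes the inequality strict.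
  have h := restSum_toReal_add_sum (k := k + 1) (i := fun j => π j ω)
    (hinj.comp Fin.val_injective) (fun l => (hpos l).le) hfin
  rw [Fin.sum_univ_eq_sum_range (fun j => Y (π j ω) ω), Finset.sum_range_succ] at h
  have h1 := hpos (π k ω)
  have h2 : 0 ≤ (restSum (fun j : Fin (k + 1) => π j ω) ENNReal.ofReal fun l => Y l ω).toReal :=
    ENNReal.toReal_nonneg
  linarith

lemma lintegral_prod_one_sub_arrangedFrac (hθ : 0 < θ)
    (hY : IsPoissonProcess P (gammaIntensity θ) Y) (hπ : IsSizeBiasedOrder P Y π) (k : ℕ) :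
    ∫⁻ ω, ∏ j, ENNReal.ofReal (1 - arrangedFrac Y π k ω j) ∂P
      = ENNReal.ofReal (θ / (θ + 1)) ^ k := by
  have : IsProbabilityMeasure (gammaMeasure θ 1) := isProbabilityMeasure_gammaMeasure hθ one_pos
  have : IsProbabilityMeasure (betaMeasure 1 θ) := isProbabilityMeasureBeta one_pos hθ
  have hS : Measurable fun ω => seqSum fun l => Y l ω :=
    measurable_seqSum.comp (measurable_pi_lambda _ hY.measurable)
  have hF : Measurable fun p : ℝ × (Fin k → ℝ) => ∏ j, ENNReal.ofReal (1 - p.2 j) := by fun_prop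
  have h := lintegral_map hF (μ := P)
    (hS.prodMk (measurable_arrangedFrac hY.measurable hπ.measurable k))
  rw [map_arrangedFrac hθ hY hπ, lintegral_prod _ hF.aemeasurable] at h
  dsimp only at h
  rw [← h, lintegral_const, measure_univ, mul_one]
  have hpow (k : ℕ) : ∫⁻ v : Fin k → ℝ, ∏ j, ENNReal.ofReal (1 - v j)
      ∂(Measure.pi fun _ => betaMeasure 1 θ) = ENNReal.ofReal (θ / (θ + 1)) ^ k := by
    induction k with
    | zero => simp
    | succ k ih =>
      rw [lintegral_pi_succ _ (by fun_prop)]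
      simp_rw [Fin.prod_univ_succ, Fin.cons_zero, Fin.cons_succ]
      have h1 := lintegral_pow_betaMeasure hθ 1
      simp only [pow_one, Nat.cast_one] at h1
      simp_rw [lintegral_const_mul' _ _ ENNReal.ofReal_ne_top, ih]
      rw [lintegral_mul_const' _ _ (by finiteness), h1, pow_succ']
  exact hpow k

/-- The size-biased rearrangement almost surely exhausts the points. -/
lemma ae_hasSum_arrangement (hθ : 0 < θ) (hY : IsPoissonProcess P (gammaIntensity θ) Y)
    (hπ : IsSizeBiasedOrder P Y π) :
    ∀ᵐ ω ∂P, HasSum (fun k => Y (π k ω) ω) (seqSum fun l => Y l ω) := by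
  -- `Z k` is the fraction of the total not yet drawn after `k` steps. It decreases and its mean
  -- tends to `0`, hence its infimum is almost surely `0`.
  let Z (k : ℕ) (ω : Ω) := ∏ j, ENNReal.ofReal (1 - arrangedFrac Y π k ω j)
  have hZm (k) : Measurable (Z k) := Finset.measurable_prod _ fun j _ =>
    (measurable_const.sub ((measurable_pi_apply j).comp
      (measurable_arrangedFrac hY.measurable hπ.measurable k))).ennreal_ofReal
  have hr : ENNReal.ofReal (θ / (θ + 1)) < 1 := by
    rw [ENNReal.ofReal_lt_one, div_lt_one (by linarith)]
    linarith
  have h0 : ∫⁻ ω, ⨅ k, Z k ω ∂P = 0 := by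
    refine le_antisymm (ge_of_tendsto' (ENNReal.tendsto_pow_atTop_nhds_zero_of_lt_one hr)
      fun k => ?_) zero_le
    rw [← lintegral_prod_one_sub_arrangedFrac hθ hY hπ k]
    exact lintegral_mono fun ω => iInf_le _ k
  rw [lintegral_eq_zero_iff (Measurable.iInf hZm)] at h0
  filter_upwards [h0, ae_remainder_pos hθ hY hπ, hY.ae_pos] with ω hω hrem hpos
  set s := seqSum fun l => Y l ω
  set x : ℕ → ℝ := fun l => Y (π l ω) ω
  have hs : 0 < s := by simpa using hrem 0
  have hZ (k) : Z k ω = ENNReal.ofReal ((s - ∑ i ∈ Finset.range k, x i) / s) := by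
    rw [← prod_one_sub_stick hrem, ENNReal.ofReal_prod_of_nonneg, ← Fin.prod_univ_eq_prod_range]
    · simp only [Z, arrangedFrac_eq_stick]
      rfl
    · intro i _
      have h1 := hrem i
      have h2 := hrem (i + 1)
      rw [Finset.sum_range_succ] at h2
      rw [stick, sub_nonneg, div_le_one h1]
      linarith
  have hanti : Antitone fun k => Z k ω := by
    refine antitone_nat_of_succ_le fun k => ?_
    rw [hZ, hZ]
    refine ENNReal.ofReal_le_ofReal ?_
    gcongr
    · intro i _ _
      exact (hpos _).le
    · omega
  have hlim := tendsto_atTop_iInf hanti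
  have hω' : ⨅ k, Z k ω = 0 := hω
  rw [hω'] at hlim
  have h1 : Tendsto (fun k => (Z k ω).toReal * s) atTop (𝓝 (0 * s)) :=
    ((ENNReal.tendsto_toReal ENNReal.zero_ne_top).comp hlim).mul_const s
  rw [zero_mul] at h1
  rw [hasSum_iff_tendsto_nat_of_nonneg fun k => (hpos _).le]
  have h2 := h1.const_sub s
  rw [sub_zero] at h2
  refine h2.congr fun k => ?_
  rw [hZ, ENNReal.toReal_ofReal (div_nonneg (hrem k).le hs.le)]
  field_simp
  ring

/-- Integration of products of polynomials in the sum and in the relative sizes. -/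
lemma integral_arrangement (hθ : 0 < θ) (hY : IsPoissonProcess P (gammaIntensity θ) Y)
    (hπ : IsSizeBiasedOrder P Y π) {F : (ℕ → ℝ) → ℝ} (p : ℝ[X]) (q : ℕ → ℝ[X]) (K : ℕ)
    (hF : AEStronglyMeasurable F (P.map fun ω k => Y (π k ω) ω))
    (h : ∀ᵐ ω ∂P, F (fun k => Y (π k ω) ω) = p.eval (seqSum fun l => Y l ω) *
      ∏ j ∈ Finset.range K, (q j).eval (stick (seqSum fun l => Y l ω) (fun l => Y (π l ω) ω) j)) :
    Integrable F (P.map fun ω k => Y (π k ω) ω) ∧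
    ∫ y, F y ∂(P.map fun ω k => Y (π k ω) ω) = (∫ x, p.eval x ∂(gammaMeasure θ 1)) *
      ∏ j ∈ Finset.range K, ∫ v, (q j).eval v ∂(betaMeasure 1 θ) := by
  have : IsProbabilityMeasure (gammaMeasure θ 1) := isProbabilityMeasure_gammaMeasure hθ one_pos
  have : IsProbabilityMeasure (betaMeasure 1 θ) := isProbabilityMeasureBeta one_pos hθ
  have hT := measurable_arrangement hY.measurable hπ.measurable
  have hS : Measurable fun ω => seqSum fun l => Y l ω :=
    measurable_seqSum.comp (measurable_pi_lambda _ hY.measurable)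
  have hΦ := hS.prodMk (measurable_arrangedFrac hY.measurable hπ.measurable K)
  let Q : ℝ × (Fin K → ℝ) → ℝ := fun z => p.eval z.1 * ∏ j : Fin K, (q j).eval (z.2 j)
  have hQ : Integrable Q ((gammaMeasure θ 1).prod (Measure.pi fun _ => betaMeasure 1 θ)) :=
    (integrable_eval_gammaMeasure hθ p).mul_prod
      (Integrable.fintype_prod (f := fun (j : Fin K) v => (q j).eval v)
        fun j => integrable_eval_betaMeasure hθ (q j))
  have hae : (fun ω => F fun k => Y (π k ω) ω) =ᵐ[P]
      fun ω => Q (seqSum fun l => Y l ω, arrangedFrac Y π K ω) := by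
    filter_upwards [h] with ω hω
    rw [hω, ← Fin.prod_univ_eq_prod_range (fun j => (q j).eval (stick (seqSum fun l => Y l ω)
      (fun l => Y (π l ω) ω) j))]
    simp only [Q, arrangedFrac_eq_stick]
  rw [← map_arrangedFrac hθ hY hπ] at hQ
  constructor
  · rw [integrable_map_measure hF hT.aemeasurable]
    exact (hQ.comp_measurable hΦ).congr hae.symm
  · rw [integral_map hT.aemeasurable hF, integral_congr_ae hae,
      ← integral_map hΦ.aemeasurable hQ.aestronglyMeasurable, map_arrangedFrac hθ hY hπ]
    simp only [Q]
    rw [integral_prod_mul (fun x => p.eval x)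
      (fun v : Fin K → ℝ => ∏ j : Fin K, (q j).eval (v j)),
      integral_fintype_prod_eq_prod (fun (j : Fin K) v => (q j).eval v),
      Fin.prod_univ_eq_prod_range (fun j => ∫ v, (q j).eval v ∂(betaMeasure 1 θ))]

end SizeBiased

/-! ### The multiple Laguerre polynomials in stick-breaking coordinates -/

lemma tailDegree_eq_sum {n : ℕ →₀ ℕ} {K : ℕ} (hK : n.support ⊆ Finset.range K) (j : ℕ) :
    tailDegree n j = ∑ i ∈ Finset.range K with j < i, n i := by
  refine Finset.sum_subset (Finset.filter_subset_filter _ hK) fun i hi hi' => ?_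
  simp only [Finset.mem_filter, Finsupp.mem_support_iff] at hi hi'
  by_contra h
  exact hi' ⟨h, hi.2⟩

/-- The factor of the multiple Laguerre polynomial that depends on the sum. -/
def radialPoly (θ : ℝ) (m : ℕ) (n : ℕ →₀ ℕ) : ℝ[X] :=
  laguerre (θ + 2 * n.degree) m * X ^ n.degree

/-- The factor of the multiple Laguerre polynomial that depends on the relative size of the `j`-th
term. -/
def stickPoly (θ : ℝ) (n : ℕ →₀ ℕ) (j : ℕ) : ℝ[X] :=
  shiftedJacobi 1 (θ + 2 * tailDegree n j) (n j) * (1 - X) ^ tailDegree n j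

/-- The products of `1 - stick s y i` telescope to the undrawn fraction, so the powers `(1 -
s_{j-1}) ^ n_j` can be redistributed: the factor with index `i` collects the exponents `n_j` of all
`j > i`, which add up to `N_i`. -/
lemma multipleLaguerre_eq_prod {θ : ℝ} (hθ : 0 < θ) (m : ℕ) {n : ℕ →₀ ℕ} {K : ℕ}
    (hK : n.support ⊆ Finset.range K) {y : ℕ → ℝ} {s : ℝ} (hs : HasSum y s)
    (hrem : ∀ k, 0 < s - ∑ i ∈ Finset.range k, y i) :
    multipleLaguerre θ m n y = (radialPoly θ m n).eval s *
      ∏ j ∈ Finset.range K, (stickPoly θ n j).eval (stick s y j) := by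
  have hs0 : 0 < s := by simpa using hrem 0
  have hfrac (j : ℕ) : 1 - ∑ i ∈ Finset.range j, y i / s
      = ∏ i ∈ Finset.range j, (1 - stick s y i) := by
    rw [prod_one_sub_stick hrem, ← Finset.sum_div]
    field_simp
  have hstick (j : ℕ) : y j / s / (1 - ∑ i ∈ Finset.range j, y i / s) = stick s y j := by
    have h := (hrem j).ne'
    rw [← Finset.sum_div, stick, show 1 - (∑ i ∈ Finset.range j, y i) / s
      = (s - ∑ i ∈ Finset.range j, y i) / s by field_simp]
    field_simp
  rw [multipleLaguerre, hs.tsum_eq, radialPoly, gemPoly, eval_mul, eval_pow, eval_X]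
  congr 1
  simp_rw [hstick, hfrac]
  rw [Finset.prod_mul_distrib]
  simp only [stickPoly, eval_mul, eval_pow, eval_sub, eval_one, eval_X, Finset.prod_mul_distrib]
  congr 1
  · refine Finset.prod_subset hK fun j _ hj => ?_
    rw [Finsupp.notMem_support_iff.1 hj, shiftedJacobi_zero (by positivity)]
  · calc ∏ j ∈ n.support, (∏ i ∈ Finset.range j, (1 - stick s y i)) ^ n j
        = ∏ j ∈ Finset.range K, ∏ i ∈ Finset.range K,
            if i < j then (1 - stick s y i) ^ n j else 1 := by
          rw [Finset.prod_subset hK fun j _ hj => by rw [Finsupp.notMem_support_iff.1 hj, pow_zero]]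
          refine Finset.prod_congr rfl fun j hj => ?_
          rw [← Finset.prod_pow, ← Finset.prod_filter]
          refine Finset.prod_congr ?_ fun _ _ => rfl
          ext i
          have := Finset.mem_range.1 hj
          simp only [Finset.mem_range, Finset.mem_filter]
          omega
      _ = _ := by
          rw [Finset.prod_comm]
          refine Finset.prod_congr rfl fun i _ => ?_
          rw [← Finset.prod_filter, Finset.prod_pow_eq_pow_sum, tailDegree_eq_sum hK]

lemma integral_radialPoly_mul {θ : ℝ} (hθ : 0 < θ) (n : ℕ →₀ ℕ) {m m' : ℕ} (h : m ≠ m') :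
    ∫ x, (radialPoly θ m n * radialPoly θ m' n).eval x ∂(gammaMeasure θ 1) = 0 := by
  rw [← integral_laguerre_mul hθ n.degree h]
  refine integral_congr_ae (Eventually.of_forall fun x => ?_)
  simp only [radialPoly, eval_mul, eval_pow, eval_X]
  ring

lemma integral_stickPoly_mul {θ : ℝ} (hθ : 0 < θ) {n n' : ℕ →₀ ℕ} {j : ℕ} (h : n j ≠ n' j)
    (h' : ∀ i, j < i → n i = n' i) :
    ∫ v, (stickPoly θ n j * stickPoly θ n' j).eval v ∂(betaMeasure 1 θ) = 0 := by
  -- Agreement beyond `j` makes the two Jacobi factors belong to the same parameter and produces the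
  -- common weight `(1 - v) ^ (2 N_j)`.
  have hN : tailDegree n' j = tailDegree n j := by
    obtain ⟨K, hK⟩ := (n.support ∪ n'.support).exists_nat_subset_range
    rw [tailDegree_eq_sum (Finset.subset_union_left.trans hK),
      tailDegree_eq_sum (Finset.subset_union_right.trans hK)]
    exact Finset.sum_congr rfl fun i hi => (h' i (Finset.mem_filter.1 hi).2).symm
  rw [← integral_shiftedJacobi_mul hθ (tailDegree n j) h]
  refine integral_congr_ae (Eventually.of_forall fun v => ?_)
  simp only [stickPoly, eval_mul, eval_pow, eval_sub, eval_one, eval_X, hN]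
  ring

lemma radialPoly_ne_zero {θ : ℝ} (hθ : 0 < θ) (m : ℕ) (n : ℕ →₀ ℕ) : radialPoly θ m n ≠ 0 :=
  mul_ne_zero (laguerre_ne_zero (by positivity) m) (pow_ne_zero _ X_ne_zero)

lemma stickPoly_ne_zero {θ : ℝ} (hθ : 0 < θ) (n : ℕ →₀ ℕ) (j : ℕ) : stickPoly θ n j ≠ 0 := by
  refine mul_ne_zero (fun h => ?_) (pow_ne_zero _ fun h => ?_)
  · have := eval_one_shiftedJacobi (b := θ + 2 * tailDegree n j) (by positivity) (n j)
    rw [h] at this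
    simp at this
  · have := congrArg (eval 0) h
    simp at this

lemma integral_radialPoly_sq_pos {θ : ℝ} (hθ : 0 < θ) (m : ℕ) (n : ℕ →₀ ℕ) :
    0 < ∫ x, (radialPoly θ m n * radialPoly θ m n).eval x ∂(gammaMeasure θ 1) := by
  have : IsProbabilityMeasure (gammaMeasure θ 1) := isProbabilityMeasure_gammaMeasure hθ one_pos
  have hint := integrable_eval_gammaMeasure hθ (radialPoly θ m n * radialPoly θ m n)
  simp only [eval_mul] at hint ⊢
  simp only [← sq] at hint ⊢
  exact integral_eval_sq_pos (radialPoly_ne_zero hθ m n) hint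

lemma integral_stickPoly_sq_pos {θ : ℝ} (hθ : 0 < θ) (n : ℕ →₀ ℕ) (j : ℕ) :
    0 < ∫ x, (stickPoly θ n j * stickPoly θ n j).eval x ∂(betaMeasure 1 θ) := by
  have : IsProbabilityMeasure (betaMeasure 1 θ) := isProbabilityMeasureBeta one_pos hθ
  have hint := integrable_eval_betaMeasure hθ (stickPoly θ n j * stickPoly θ n j)
  simp only [eval_mul] at hint ⊢
  simp only [← sq] at hint ⊢
  exact integral_eval_sq_pos (stickPoly_ne_zero hθ n j) hint

section SizeBiased

variable {Ω : Type*} [MeasurableSpace Ω] {P : Measure Ω} [IsProbabilityMeasure P]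
  {Y : ℕ → Ω → ℝ} {π : ℕ → Ω → ℕ} {θ : ℝ}

/-- Measurability is checked after replacing the real series by `seqSum`, a sum in `[0, ∞]`. The two
agree on nonnegative sequences, which carry the law. -/
lemma aestronglyMeasurable_multipleLaguerre (hY : IsPoissonProcess P (gammaIntensity θ) Y)
    (hπ : IsSizeBiasedOrder P Y π) (m : ℕ) (n : ℕ →₀ ℕ) :
    AEStronglyMeasurable (multipleLaguerre θ m n) (P.map fun ω k => Y (π k ω) ω) := by
  have heval (p : ℝ[X]) {g : (ℕ → ℝ) → ℝ} (hg : Measurable g) : Measurable fun y => p.eval (g y) :=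
    p.continuous.measurable.comp hg
  have hmeas : Measurable fun y : ℕ → ℝ => (laguerre (θ + 2 * n.degree) m).eval (seqSum y) *
      seqSum y ^ n.degree * gemPoly θ n (fun j => y j / seqSum y) := by
    unfold gemPoly
    refine ((heval _ measurable_seqSum).mul (measurable_seqSum.pow_const _)).mul ?_
    refine Finset.measurable_prod _ fun j _ => (heval _ (by fun_prop)).mul (by fun_prop)
  have hnn : ∀ᵐ y ∂(P.map fun ω k => Y (π k ω) ω), ∀ l, 0 ≤ y l := by
    rw [ae_all_iff]
    intro l
    rw [ae_map_iff (measurable_arrangement hY.measurable hπ.measurable).aemeasurable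
      (measurableSet_le measurable_const (measurable_pi_apply l))]
    filter_upwards [hY.ae_pos] with ω hω
    exact (hω _).le
  refine hmeas.aestronglyMeasurable.congr ?_
  filter_upwards [hnn] with y hy
  rw [multipleLaguerre, ← seqSum_eq_tsum hy]

lemma ae_multipleLaguerre_eq_prod (hθ : 0 < θ) (hY : IsPoissonProcess P (gammaIntensity θ) Y)
    (hπ : IsSizeBiasedOrder P Y π) (m : ℕ) {n : ℕ →₀ ℕ} {K : ℕ}
    (hK : n.support ⊆ Finset.range K) :
    ∀ᵐ ω ∂P, multipleLaguerre θ m n (fun k => Y (π k ω) ω)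
      = (radialPoly θ m n).eval (seqSum fun l => Y l ω) * ∏ j ∈ Finset.range K,
        (stickPoly θ n j).eval (stick (seqSum fun l => Y l ω) (fun l => Y (π l ω) ω) j) := by
  filter_upwards [ae_hasSum_arrangement hθ hY hπ, ae_remainder_pos hθ hY hπ] with ω h1 h2
  exact multipleLaguerre_eq_prod hθ m hK h1 h2

lemma integral_multipleLaguerre_mul (hθ : 0 < θ) (hY : IsPoissonProcess P (gammaIntensity θ) Y)
    (hπ : IsSizeBiasedOrder P Y π) (m m' : ℕ) {n n' : ℕ →₀ ℕ} {K : ℕ}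
    (hK : n.support ⊆ Finset.range K) (hK' : n'.support ⊆ Finset.range K) :
    Integrable (fun y => multipleLaguerre θ m n y * multipleLaguerre θ m' n' y)
      (P.map fun ω k => Y (π k ω) ω) ∧
    ∫ y, multipleLaguerre θ m n y * multipleLaguerre θ m' n' y ∂(P.map fun ω k => Y (π k ω) ω)
      = (∫ x, (radialPoly θ m n * radialPoly θ m' n').eval x ∂(gammaMeasure θ 1)) *
        ∏ j ∈ Finset.range K,
          ∫ v, (stickPoly θ n j * stickPoly θ n' j).eval v ∂(betaMeasure 1 θ) := by
  refine integral_arrangement hθ hY hπ _ (fun j => stickPoly θ n j * stickPoly θ n' j) K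
    ((aestronglyMeasurable_multipleLaguerre hY hπ m n).mul
      (aestronglyMeasurable_multipleLaguerre hY hπ m' n')) ?_
  filter_upwards [ae_multipleLaguerre_eq_prod hθ hY hπ m hK,
    ae_multipleLaguerre_eq_prod hθ hY hπ m' hK'] with ω h1 h2
  rw [h1, h2]
  simp only [eval_mul, Finset.prod_mul_distrib]
  ring

theorem isOrthogonalSystem_multipleLaguerre (hθ : 0 < θ)
    (hY : IsPoissonProcess P (gammaIntensity θ) Y) (hπ : IsSizeBiasedOrder P Y π) :
    IsOrthogonalSystem (P.map fun ω k => Y (π k ω) ω)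
      (fun i : ℕ × (ℕ →₀ ℕ) => multipleLaguerre θ i.1 i.2) where
  memLp := by
    rintro ⟨m, n⟩
    obtain ⟨K, hK⟩ := n.support.exists_nat_subset_range
    rw [memLp_two_iff_integrable_sq (aestronglyMeasurable_multipleLaguerre hY hπ m n)]
    simp_rw [sq]
    exact (integral_multipleLaguerre_mul hθ hY hπ m m hK hK).1
  orthogonal := by
    rintro ⟨m, n⟩ ⟨m', n'⟩ hne
    obtain ⟨K, hK⟩ := (n.support ∪ n'.support).exists_nat_subset_range
    simp only
    rw [(integral_multipleLaguerre_mul hθ hY hπ m m' (Finset.subset_union_left.trans hK)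
      (Finset.subset_union_right.trans hK)).2]
    by_cases hn : n = n'
    · subst hn
      rw [integral_radialPoly_mul hθ n fun h => hne (by rw [h]), zero_mul]
    · have hD : ((Finset.range K).filter fun j => n j ≠ n' j).Nonempty := by
        by_contra h
        refine hn (Finsupp.ext fun j => ?_)
        by_contra hj
        refine h ⟨j, Finset.mem_filter.2 ⟨hK ?_, hj⟩⟩
        simp only [Finset.mem_union, Finsupp.mem_support_iff]
        omega
      -- The last index of disagreement has to be chosen: at an earlier one the tail degrees, and
      -- with them the Jacobi parameters, might differ.
      obtain ⟨j, hj, hmax⟩ := Finset.exists_max_image _ id hD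
      rw [Finset.mem_filter] at hj
      have hlast : ∀ i, j < i → n i = n' i := by
        intro i hi
        by_contra hi'
        have hiK : i ∈ Finset.range K := hK (by
          simp only [Finset.mem_union, Finsupp.mem_support_iff]
          omega)
        have := hmax i (Finset.mem_filter.2 ⟨hiK, hi'⟩)
        simp only [id] at this
        omega
      rw [Finset.prod_eq_zero hj.1 (integral_stickPoly_mul hθ hj.2 hlast), mul_zero]
  norm_pos := by
    rintro ⟨m, n⟩
    obtain ⟨K, hK⟩ := n.support.exists_nat_subset_range
    simp_rw [sq]
    rw [(integral_multipleLaguerre_mul hθ hY hπ m m hK hK).2]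
    exact mul_pos (integral_radialPoly_sq_pos hθ m n)
      (Finset.prod_pos fun j _ => integral_stickPoly_sq_pos hθ n j)

end SizeBiased

/-! ### The multiple Laguerre polynomials as polynomials -/

/-- The homogeneous polynomial `R_d^{(1, b)}(y_j / w) w ^ d` with `w = |y| - ∑_{i < j} y_i`. -/
def homJacobi (b : ℝ) (d j : ℕ) : MvPolynomial (Option ℕ) ℝ :=
  ∑ k ∈ Finset.range (d + 1), MvPolynomial.C (jacobiCoeff b d k) *
    ((MvPolynomial.X none - ∑ i ∈ Finset.range j, MvPolynomial.X (some i)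
      - MvPolynomial.X (some j)) ^ k *
    (MvPolynomial.X none - ∑ i ∈ Finset.range j, MvPolynomial.X (some i)) ^ (d - k))

lemma isHomogeneous_homJacobi (b : ℝ) (d j : ℕ) : (homJacobi b d j).IsHomogeneous d := by
  refine MvPolynomial.IsHomogeneous.sum _ _ _ fun k hk => ?_
  have hX (o : Option ℕ) := MvPolynomial.isHomogeneous_X ℝ o
  have hW : (MvPolynomial.X none - ∑ i ∈ Finset.range j, MvPolynomial.X (some i) :
      MvPolynomial (Option ℕ) ℝ).IsHomogeneous 1 :=
    (hX none).sub (MvPolynomial.IsHomogeneous.sum _ _ _ fun i _ => hX (some i))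
  have h := (MvPolynomial.isHomogeneous_C (Option ℕ) (jacobiCoeff b d k)).mul
    (((hW.sub (hX (some j))).pow k).mul (hW.pow (d - k)))
  have hk' := Nat.lt_succ_iff.1 (Finset.mem_range.1 hk)
  convert! h using 1
  omega

lemma eval_homJacobi {b : ℝ} (hb : 0 < b) (d j : ℕ) (z : Option ℕ → ℝ)
    (hw : z none - ∑ i ∈ Finset.range j, z (some i) ≠ 0) :
    MvPolynomial.eval z (homJacobi b d j) = (shiftedJacobi 1 b d).eval
      (z (some j) / (z none - ∑ i ∈ Finset.range j, z (some i))) *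
      (z none - ∑ i ∈ Finset.range j, z (some i)) ^ d := by
  rw [homJacobi, map_sum, eval_shiftedJacobi hb, Finset.sum_mul]
  refine Finset.sum_congr rfl fun k hk => ?_
  obtain ⟨e, rfl⟩ := Nat.exists_eq_add_of_le (Nat.lt_succ_iff.1 (Finset.mem_range.1 hk))
  simp only [map_mul, map_pow, map_sub, map_sum, MvPolynomial.eval_C, MvPolynomial.eval_X,
    Nat.add_sub_cancel_left]
  rw [one_sub_div hw, div_pow, pow_add]
  field_simp

lemma homJacobi_ne_zero {b : ℝ} (hb : 0 < b) (d j : ℕ) : homJacobi b d j ≠ 0 := by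
  intro h
  -- At this point `w = 1` and `y_j = w`, so the value is `R_d(1) = 1`.
  have h1 := eval_homJacobi hb d j
    (fun o => o.elim 1 fun i => if i = j then 1 else 0) (by simp)
  rw [h] at h1
  simp [eval_one_shiftedJacobi hb] at h1

lemma totalDegree_aeval_X {σ : Type*} (o : σ) (p : ℝ[X]) :
    (aeval (MvPolynomial.X o : MvPolynomial σ ℝ) p).totalDegree = p.natDegree := by
  classical
  have hsum : aeval (MvPolynomial.X o : MvPolynomial σ ℝ) p
      = ∑ k ∈ Finset.range (p.natDegree + 1),
        MvPolynomial.C (p.coeff k) * MvPolynomial.X o ^ k := by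
    rw [aeval_eq_sum_range]
    simp_rw [MvPolynomial.smul_eq_C_mul]
  refine le_antisymm ?_ ?_
  · rw [hsum]
    refine MvPolynomial.totalDegree_finsetSum_le fun k hk => ?_
    rw [← MvPolynomial.smul_eq_C_mul]
    refine (MvPolynomial.totalDegree_smul_le _ _).trans ?_
    rw [MvPolynomial.totalDegree_X_pow]
    exact Nat.lt_succ_iff.1 (Finset.mem_range.1 hk)
  · by_cases hp : p = 0
    · simp [hp]
    have hc : MvPolynomial.coeff (Finsupp.single o p.natDegree)
        (aeval (MvPolynomial.X o : MvPolynomial σ ℝ) p) = p.leadingCoeff := by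
      rw [hsum, MvPolynomial.coeff_sum, Finset.sum_eq_single p.natDegree]
      · rw [MvPolynomial.coeff_C_mul, MvPolynomial.coeff_X_pow, if_pos rfl, mul_one]
        rfl
      · intro k _ hk
        rw [MvPolynomial.coeff_C_mul, MvPolynomial.coeff_X_pow, if_neg, mul_zero]
        intro h
        exact hk (Finsupp.single_injective o h)
      · simp
    have := MvPolynomial.le_totalDegree (p := aeval (MvPolynomial.X o : MvPolynomial σ ℝ) p)
      (s := Finsupp.single o p.natDegree)
      (by rw [MvPolynomial.mem_support_iff, hc]; exact leadingCoeff_ne_zero.2 hp)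
    simpa using this

/-- The degree is exact because the representing polynomial is a product of nonzero factors over a
domain: the Laguerre polynomial in the variable `none`, of degree `m`, and a product of homogeneous
factors of degrees `n_j`. -/
theorem isPolynomialOfDegree_multipleLaguerre {θ : ℝ} (hθ : 0 < θ) (m : ℕ) (n : ℕ →₀ ℕ) :
    IsPolynomialOfDegree (multipleLaguerre θ m n) (m + n.degree) := by
  have ha : 0 < θ + 2 * (n.degree : ℝ) := by positivity
  have hb (j) : 0 < θ + 2 * (tailDegree n j : ℝ) := by positivity
  have hdeg := natDegree_laguerre ha m
  set q := ∏ j ∈ n.support, homJacobi (θ + 2 * tailDegree n j) (n j) j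
  have hq0 : q ≠ 0 := Finset.prod_ne_zero_iff.2 fun j _ => homJacobi_ne_zero (hb j) _ _
  have hq : q.totalDegree = n.degree :=
    (MvPolynomial.IsHomogeneous.prod _ _ _ fun j _ =>
      isHomogeneous_homJacobi _ _ _).totalDegree hq0
  have hL : aeval (MvPolynomial.X none : MvPolynomial (Option ℕ) ℝ)
      (laguerre (θ + 2 * n.degree) m) ≠ 0 := by
    intro h
    refine laguerre_ne_zero ha m (Polynomial.funext fun x => ?_)
    have h1 := congrArg (MvPolynomial.eval fun _ => x) h
    rw [aeval_eq_sum_range] at h1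
    rw [eval_eq_sum_range, eval_zero]
    simpa [MvPolynomial.smul_eval] using h1
  refine ⟨aeval (MvPolynomial.X none) (laguerre (θ + 2 * n.degree) m) * q, ?_, ?_⟩
  · rw [MvPolynomial.totalDegree_mul_of_isDomain hL hq0, totalDegree_aeval_X, hdeg, hq]
  · intro y hpos hsum
    have hs : 0 < ∑' i, y i := hsum.tsum_pos (fun i => (hpos i).le) 0 (hpos 0)
    set s := ∑' i, y i with hsdef
    -- Positivity of all terms keeps the denominators away from zero: `y j` is still contained in
    -- the remainder.
    have hrem (j) : s - ∑ i ∈ Finset.range j, y i ≠ 0 := by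
      have := hsum.sum_le_tsum (Finset.range (j + 1)) fun i _ => (hpos i).le
      rw [Finset.sum_range_succ] at this
      have := hpos j
      apply ne_of_gt
      linarith
    rw [map_mul, map_prod, multipleLaguerre, ← hsdef, mul_assoc]
    congr 1
    · rw [aeval_eq_sum_range, eval_eq_sum_range]
      simp [MvPolynomial.smul_eval]
    -- The power `|y| ^ |n|` is split as `∏_j |y| ^ n_j`, so that each factor homogenizes its own
    -- Jacobi polynomial.
    · rw [gemPoly, show n.degree = ∑ j ∈ n.support, n j from rfl, ← Finset.prod_pow_eq_pow_sum,
        ← Finset.prod_mul_distrib]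
      refine Finset.prod_congr rfl fun j _ => ?_
      rw [eval_homJacobi (hb j) _ _ _ (hrem j)]
      simp only [Option.elim]
      have h1 : 1 - ∑ i ∈ Finset.range j, y i / s = (s - ∑ i ∈ Finset.range j, y i) / s := by
        rw [← Finset.sum_div]
        field_simp
      have h2 := hrem j
      rw [h1, show y j / s / ((s - ∑ i ∈ Finset.range j, y i) / s)
        = y j / (s - ∑ i ∈ Finset.range j, y i) by field_simp, div_pow]
      field_simp

end

end GammaLaguerre

theorem corollary4p5 {Ω : Type*} [MeasurableSpace Ω] (P : Measure Ω) [IsProbabilityMeasure P]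
    (θ : ℝ) (hθ : 0 < θ) (Y : ℕ → Ω → ℝ) (π : ℕ → Ω → ℕ)
    (hY : GammaLaguerre.IsPoissonProcess P (GammaLaguerre.gammaIntensity θ) Y)
    (hπ : GammaLaguerre.IsSizeBiasedOrder P Y π) :
    (∀ (m : ℕ) (n : ℕ →₀ ℕ),
      GammaLaguerre.IsPolynomialOfDegree (GammaLaguerre.multipleLaguerre θ m n) (m + n.degree)) ∧
    GammaLaguerre.IsOrthogonalSystem (P.map (fun ω k => Y (π k ω) ω))
      (fun i : ℕ × (ℕ →₀ ℕ) => GammaLaguerre.multipleLaguerre θ i.1 i.2) :=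
  ⟨fun m n => GammaLaguerre.isPolynomialOfDegree_multipleLaguerre hθ m n,
    GammaLaguerre.isOrthogonalSystem_multipleLaguerre hθ hY hπ⟩
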